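/- Let $D$ be a probability distribution on a measurable space $\Xi$ and consider $$\min_{x\in\mathbb{R}^n}\ \psi(x):=f(x)+\varphi(x),\qquad f(x)=\mathbb{E}_{\xi\sim D}[f(x,\xi)],$$ where $\varphi:\mathbb{R}^n\to(-\infty,\infty]$ is proper, lower semicontinuous and weakly convex, $U$ is an open convex set containing $\operatorname{dom}\varphi=\{x:\varphi(x)<\infty\}$, $f(x,\cdot)$ is $D$-integrable for every $x\in U$, $f$ is weakly convex on $U$, and $\psi$ is bounded from below on $\operatorname{dom}\varphi$. (A function $h$ is $\rho$-weakly convex if $h+\frac{\rho}{2}\|\cdot\|^2$ is convex on $\operatorname{dom}h$, and weakly convex if this holds for some $\rho$.) Let $(x,y,\xi)\mapsto f_x(y,\xi)\in\mathbb{R}$ be a model function that is jointly measurable on $U\times U\times\Xi$, with $f_x(y,\cdot)$ integrable with respect to $D$ for all $x,y\in U$, and suppose that there are constants $\tau,\eta\in\mathbb{R}$, ${\sf L}>0$, ${\sf L}_\varphi\ge 0$ such that 1. $\mathbb{E}_\xi[f_x(x,\xi)]=f(x)$ for all $x\in U$, and $\mathbb{E}_\xi[f_x(y,\xi)-f(y)]\le\frac{\tau}{2}\|x-y\|^2$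 for all $x,y\in U$; 2. for every $x\in U$ and almost every $\xi$, the function $y\mapsto f_x(y,\xi)+\varphi(y)$ is $\eta$-weakly convex; 3. for all $x,y\in U$ and almost every $\xi$, $f_x(x,\xi)-f_x(y,\xi)\le{\sf L}\|x-y\|$; 4. $\varphi$ is ${\sf L}_\varphi$-Lipschitz continuous on $\operatorname{dom}\varphi$; 5. the step sizes $\alpha_k>0$ satisfy $\sum_{k=0}^\infty\alpha_k=\infty$ and $\sum_{k=0}^\infty\alpha_k^2<\infty$. Let $\xi^0,\xi^1,\dots$ be independent random variables with distribution $D$, let $\mathcal{F}_k=\sigma(\xi^0,\dots,\xi^{k-1})$ ($\mathcal{F}_0$ is trivial), and let $\{x^k\}_{k\ge0}$ be generated by the stochastic model-based method: each $x^k$ is $\mathcal{F}_k$-measurable, $x^0\in U$, and for every $k$, almost surely, $$x^{k+1}\in\operatorname*{argmin}_{x\in\mathbb{R}^n}\ f_{x^k}(x,\xi^k)+\varphi(x)+\frac{1}{2\alpha_k}\|x-x^k\|^2 .$$ Let $\theta>0$ with $\theta(\tau+\eta)<1$. Then the Moreau envelope $\mathrm{env}_{\theta\psi}(x)=\min_{y\in\mathbb{R}^n}\psi(y)+\frac{1}{2\theta}\|x-y\|^2$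 is well defined (the minimum is finite and attained for every $x\in\mathbb{R}^n$) and differentiable on $\mathbb{R}^n$, the random variables $\|\nabla\mathrm{env}_{\theta\psi}(x^k)\|$ are integrable, and $$\lim_{k\to\infty}\mathbb{E}\big[\|\nabla\mathrm{env}_{\theta\psi}(x^k)\|\big]=0,\qquad \lim_{k\to\infty}\|\nabla\mathrm{env}_{\theta\psi}(x^k)\|=0\ \text{ almost surely.}$$ -/

import Mathlib

open MeasureTheory ProbabilityTheory Filter Topology
open scoped NNReal

/-- The effective domain `{x | h x < ∞}` of an extended-real-valued function. -/
def effDom {E : Type*} (h : E → EReal) : Set E := {x | h x < ⊤}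

/-- A proper function: it takes values in `(-∞, ∞]` and is finite somewhere. -/
def IsProperFun {E : Type*} (h : E → EReal) : Prop :=
  (∀ x, h x ≠ ⊥) ∧ (effDom h).Nonempty

/-- `ρ`-weak convexity of a real function on a set `S`:
`S` is convex and `h + (ρ / 2) ‖·‖²` is convex on `S`. -/
def WeaklyConvexOn {E : Type*} [NormedAddCommGroup E] [NormedSpace ℝ E]
    (ρ : ℝ) (S : Set E) (h : E → ℝ) : Prop :=
  ConvexOn ℝ S (fun x => h x + ρ / 2 * ‖x‖ ^ 2)

/-- `ρ`-weak convexity of a function with values in `(-∞, ∞]`: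
`h + (ρ / 2) ‖·‖²` is convex on the effective domain of `h` (which is then a convex set). -/
def WeaklyConvex {E : Type*} [NormedAddCommGroup E] [NormedSpace ℝ E]
    (ρ : ℝ) (h : E → EReal) : Prop :=
  (∀ x, h x ≠ ⊥) ∧ WeaklyConvexOn ρ (effDom h) (fun x => (h x).toReal)

/-- The function `y ↦ h y + ‖y - x‖² / (2 t)` that is minimized in a proximal step at `x`
with parameter `t`. -/
noncomputable def proxObjective {E : Type*} [NormedAddCommGroup E]
    (t : ℝ) (h : E → EReal) (x y : E) : EReal :=
  h y + ((1 / (2 * t) * ‖y - x‖ ^ 2 : ℝ) : EReal)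

/-- The Moreau envelope `env_{t h}(x) = inf_y (h y + ‖x - y‖² / (2 t))`, as a real number
(this is the infimum itself whenever the infimum is finite). -/
noncomputable def moreauEnv {E : Type*} [NormedAddCommGroup E]
    (t : ℝ) (h : E → EReal) (x : E) : ℝ :=
  (⨅ y, proxObjective t h x y).toReal

/-- The objective `ψ(x) = 𝔼_{s ∼ D}[F(x, s)] + φ(x)`. -/
noncomputable def compositeObjective {E Ξ : Type*} [MeasurableSpace Ξ]
    (D : Measure Ξ) (F : E → Ξ → ℝ) (φ : E → EReal) (x : E) : EReal :=
  ((∫ s, F x s ∂D : ℝ) : EReal) + φ x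

/-- The σ-algebra `σ(ξ⁰, …, ξᵏ⁻¹)` generated by the first `k` samples (trivial for `k = 0`). -/
abbrev sampleHistory {Ω Ξ : Type*} [MeasurableSpace Ξ] (ξ : ℕ → Ω → Ξ) (k : ℕ) :
    MeasurableSpace Ω :=
  ⨆ i : Fin k, MeasurableSpace.comap (ξ i) inferInstance

/-! ### Real sequences -/

/-! Let `p z` be the minimizer of `ψ + ‖· - z‖² / (2θ)`. Averaging the models shows that `ψ` is `(τ
+ η)`-weakly convex on its domain `C`, and `θ(τ + η) < 1` makes the proximal problem strongly
convex. Hence `p` is Lipschitz and the envelope has gradient `(z - p z)/θ`, so the claim is that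
`‖xᵏ - p(xᵏ)‖` tends to zero, in mean and almost surely.

Write `κ = 1/θ - (τ + η)` and `Λ = L + Lφ`. Strong convexity of the step problem, tested at `p(xᵏ)`,
together with accuracy and Lipschitz bounds of the model, gives `(1 - αη) 𝔼‖xᵏ⁺¹ - p(xᵏ)‖² ≤ (1 - αη
- 2ακ) 𝔼‖xᵏ - p(xᵏ)‖² + α²Λ²` (`integral_norm_sq_prox_sub_succ_le`). Using `p(xᵏ)` as a candidate in
the envelope at `xᵏ⁺¹` turns this into a descent inequality for the expected envelope, and
telescoping yields `∑ αₖ 𝔼‖xᵏ - p(xᵏ)‖² < ∞` (`summable_integral_norm_sq`).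

Summability alone only gives a vanishing subsequence. The full limit comes from the step bound
`‖xᵏ⁺¹ - xᵏ‖ ≤ 2Λαₖ` for `xᵏ ∈ C`: the increments of `‖xᵏ - p(xᵏ)‖` are `O(αₖ)`, and
`tendsto_zero_of_summable_mul_sq` applies both to the means and to almost every path.

The measure-theoretic difficulty is that the exceptional null sets of the model hypotheses depend on
the points, whereas `xᵏ` is random and `xᵏ⁺¹` depends on the fresh sample. Countable test sets and
Fubini, using independence, handle this (`Convex.exists_countable_test`, `ae_mem_of_forall_ae`). -/

theorem summable_of_descent {e a c : ℕ → ℝ} {b : ℝ} (he : ∀ k, b ≤ e k) (ha : ∀ k, 0 ≤ a k)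
    (hc0 : ∀ k, 0 ≤ c k) (hc : Summable c) (h : ∀ k, e (k + 1) ≤ e k - a k + c k) :
    Summable a := by
  refine summable_of_sum_range_le (c := e 0 - b + ∑' k, c k) ha fun m => ?_
  have key : ∑ k ∈ Finset.range m, a k ≤ e 0 - e m + ∑ k ∈ Finset.range m, c k := by
    induction m with
    | zero => simp
    | succ m ih =>
      rw [Finset.sum_range_succ, Finset.sum_range_succ]
      linarith [h m]
  have := hc.sum_le_tsum (Finset.range m) (fun k _ => hc0 k)
  linarith [he m]

/-- A nonnegative sequence `w` with `∑ α w² < ∞`, `∑ α = ∞`, `∑ α² < ∞` whose increments are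
`O(α)` tends to zero. -/
theorem tendsto_zero_of_summable_mul_sq {α w : ℕ → ℝ} {C : ℝ} (hα : ∀ k, 0 < α k)
    (hw : ∀ k, 0 ≤ w k)
    (hα_sum : Tendsto (fun K => ∑ k ∈ Finset.range K, α k) atTop atTop)
    (hα_sq : Summable (fun k => α k ^ 2))
    (hsum : Summable (fun k => α k * w k ^ 2))
    (hinc : ∀ k, |w (k + 1) - w k| ≤ C * α k) :
    Tendsto w atTop (𝓝 0) := by
  have hC : 0 ≤ C := by
    have := (abs_nonneg _).trans (hinc 0)
    exact nonneg_of_mul_nonneg_left this (hα 0)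
  obtain ⟨A, hA⟩ : ∃ A, ∀ k, α k ^ 2 ≤ A :=
    ⟨∑' k, α k ^ 2, fun k => hα_sq.le_tsum k fun j _ => sq_nonneg _⟩
  have hA' : ∀ k, α k ≤ A + 1 := fun k => by nlinarith [hA k, sq_nonneg (α k - 1), hα k]
  -- Cubes are used because an increment of `w³` is an increment of `w` times roughly `3w²`, hence
  -- of order `α w²`, which is summable. The remainders `α²w` and `α³` are absorbed into `α w²` and
  -- `α²`.
  have hsummable : Summable fun k => dist (w k ^ 3) (w k.succ ^ 3) := by
    refine Summable.of_nonneg_of_le (fun k => dist_nonneg) (f := fun k =>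
      C * ((3 + 3 / 2 * C) * (α k * w k ^ 2)) +
        C * ((3 / 2 * C + C ^ 2) * (A + 1) * α k ^ 2)) (fun k => ?_)
      (((hsum.mul_left _).mul_left _).add ((hα_sq.mul_left _).mul_left _))
    have h1 := hinc k
    have h2 : w (k + 1) ≤ w k + C * α k := by linarith [le_abs_self (w (k + 1) - w k)]
    have h3 : w (k + 1) ^ 2 + w (k + 1) * w k + w k ^ 2
        ≤ 3 * w k ^ 2 + 3 * (C * (α k * w k)) + C ^ 2 * α k ^ 2 := by
      nlinarith [hw k, hw (k + 1), mul_nonneg hC (hα k).le]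
    have h4 : 0 ≤ w (k + 1) ^ 2 + w (k + 1) * w k + w k ^ 2 := by
      have := mul_nonneg (hw (k + 1)) (hw k); positivity
    have hb : α k * (3 * w k ^ 2 + 3 * (C * (α k * w k)) + C ^ 2 * α k ^ 2) ≤
        (3 + 3 / 2 * C) * (α k * w k ^ 2) + (3 / 2 * C + C ^ 2) * (A + 1) * α k ^ 2 := by
      have h5 : α k * (α k * w k) ≤ α k * w k ^ 2 / 2 + α k ^ 3 / 2 := by
        have := mul_nonneg (hα k).le (sq_nonneg (α k - w k))
        nlinarith
      have h6 : α k ^ 3 ≤ (A + 1) * α k ^ 2 := by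
        have := mul_le_mul_of_nonneg_right (hA' k) (sq_nonneg (α k))
        nlinarith
      have h7 := mul_le_mul_of_nonneg_left h5 hC
      have h8 := mul_le_mul_of_nonneg_left h6 hC
      have h9 := mul_le_mul_of_nonneg_left h6 (sq_nonneg C)
      nlinarith
    rw [Real.dist_eq, abs_sub_comm]
    calc |w (k + 1) ^ 3 - w k ^ 3|
        = |w (k + 1) - w k| * (w (k + 1) ^ 2 + w (k + 1) * w k + w k ^ 2) := by
          conv_rhs => rw [← abs_of_nonneg h4, ← abs_mul]
          congr 1; ring
      _ ≤ (C * α k) * (3 * w k ^ 2 + 3 * (C * (α k * w k)) + C ^ 2 * α k ^ 2) :=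
          mul_le_mul h1 h3 h4 (mul_nonneg hC (hα k).le)
      _ = C * (α k * (3 * w k ^ 2 + 3 * (C * (α k * w k)) + C ^ 2 * α k ^ 2)) := by ring
      _ ≤ _ := by
          refine (mul_le_mul_of_nonneg_left hb hC).trans (le_of_eq ?_); ring
  obtain ⟨l, hl⟩ := cauchySeq_tendsto_of_complete (cauchySeq_of_summable_dist hsummable)
  have hl0 : 0 ≤ l := ge_of_tendsto' hl fun k => pow_nonneg (hw k) 3
  have hroot : ∀ k, w k = (w k ^ 3) ^ ((3 : ℝ)⁻¹) := fun k => by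
    have := Real.pow_rpow_inv_natCast (hw k) (n := 3) (by norm_num)
    exact_mod_cast this.symm
  have hwl : Tendsto w atTop (𝓝 (l ^ ((3 : ℝ)⁻¹))) := by
    rw [funext hroot]
    exact hl.rpow_const (Or.inr (by norm_num))
  rcases hl0.eq_or_lt with h0 | hpos
  · rw [← h0, Real.zero_rpow (by norm_num)] at hwl
    exact hwl
  exfalso
  set r := l ^ ((3 : ℝ)⁻¹) with hr
  have hrpos : 0 < r := Real.rpow_pos_of_pos hpos _
  have hev : ∀ᶠ k in atTop, r / 2 < w k := hwl.eventually_const_lt (by linarith)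
  -- A positive limit would bound `α` eventually by a multiple of the summable `α w²`, contradicting
  -- `∑ α = ∞`.
  have hsα : Summable α := by
    refine Summable.of_norm_bounded_eventually_nat (g := fun k => (4 / r ^ 2) * (α k * w k ^ 2))
      (hsum.mul_left _) ?_
    filter_upwards [hev] with k hk
    rw [Real.norm_of_nonneg (hα k).le]
    have : r ^ 2 / 4 ≤ w k ^ 2 := by nlinarith
    have h2 := mul_le_mul_of_nonneg_left this (hα k).le
    have h3 := mul_le_mul_of_nonneg_left h2 (by positivity : 0 ≤ 4 / r ^ 2)
    refine le_trans (le_of_eq ?_) h3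
    field_simp
  exact not_tendsto_nhds_of_tendsto_atTop hα_sum _ hsα.hasSum.tendsto_sum_nat

/-! ### Convex functions -/

/-- On a convex set of a finite-dimensional space, a lower bound of a convex function by a
continuous function has to be tested on a countable set only. -/
theorem Convex.exists_countable_test {E : Type*} [NormedAddCommGroup E] [NormedSpace ℝ E]
    [FiniteDimensional ℝ E] {C : Set E} (hC : Convex ℝ C) (hne : C.Nonempty) :
    ∃ Q : Set E, Q.Countable ∧ Q ⊆ C ∧ ∀ G l : E → ℝ, ConvexOn ℝ C G → ContinuousOn l C →
      (∀ q ∈ Q, l q ≤ G q) → ∀ y ∈ C, l y ≤ G y := by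
  obtain ⟨a, ha⟩ := hne
  set S : Set E := {v | a + v ∈ C} with hS
  -- `C` may have empty interior in `E`; translated into the span of `C - a` it has nonempty
  -- interior, where convex functions are continuous.
  set V := Submodule.span ℝ S
  set C' : Set V := (fun v : V => (v : E)) ⁻¹' S with hC'
  let g : V →ᵃ[ℝ] E :=
    (AffineMap.const ℝ V a) + V.subtype.toAffineMap
  have hg : ∀ v : V, g v = a + (v : E) := fun v => by simp [g]
  have hgc : Continuous g := by
    have : (g : V → E) = fun v : V => a + (v : E) := funext hg
    rw [this]; fun_prop
  have hpre : C' = g ⁻¹' C := by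
    ext v; simp [hC', hS, hg]
  have hconv : Convex ℝ C' := by
    rw [hpre]; exact hC.affine_preimage g
  have h0 : (0 : V) ∈ C' := by simp [hC', hS, ha]
  have hint : (interior C').Nonempty := by
    rw [hconv.interior_nonempty_iff_affineSpan_eq_top,
      AffineSubspace.affineSpan_eq_top_iff_vectorSpan_eq_top_of_nonempty ℝ V V ⟨0, h0⟩,
      vectorSpan_eq_span_vsub_set_right ℝ h0]
    have : (fun x : V => x -ᵥ (0 : V)) '' C' = C' := by simp
    rw [this]
    exact Submodule.span_span_coe_preimage
  obtain ⟨v0, hv0⟩ := hint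
  obtain ⟨T, hTc, hTd⟩ := TopologicalSpace.exists_countable_dense V
  refine ⟨g '' (interior C' ∩ T), (hTc.mono Set.inter_subset_right).image _, ?_, ?_⟩
  · rintro _ ⟨v, hv, rfl⟩
    have := interior_subset hv.1
    rwa [hpre] at this
  intro G l hG hl hQ
  have hGc : ContinuousOn (G ∘ g) (interior C') := by
    have : ConvexOn ℝ C' (G ∘ g) := by rw [hpre]; exact hG.comp_affineMap g
    exact this.continuousOn_interior
  have hmaps : Set.MapsTo g C' C := fun v hv => by rwa [hpre] at hv
  have hlc : ContinuousOn (l ∘ g) C' := hl.comp hgc.continuousOn hmaps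
  have hinter : ∀ v ∈ interior C', l (g v) ≤ G (g v) := by
    intro v hv
    have hcl : v ∈ closure (interior C' ∩ T) := hTd.open_subset_closure_inter isOpen_interior hv
    exact ContinuousWithinAt.closure_le (f := l ∘ g) (g := G ∘ g) hcl
      ((hlc.mono interior_subset v hv).mono Set.inter_subset_left)
      ((hGc v hv).mono Set.inter_subset_left) fun w hw => hQ _ ⟨w, hw, rfl⟩
  intro y hy
  have hyS : y - a ∈ S := by simpa [hS] using hy
  let v : V := ⟨y - a, Submodule.subset_span hyS⟩
  have hv : v ∈ C' := hyS
  have hgv : g v = y := by simp [hg, v]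
  let p : ℝ → V := fun t => (1 - t) • v + t • v0
  have hp0 : p 0 = v := by simp [p]
  have hpc : Continuous p := by fun_prop
  have hpint : ∀ t ∈ Set.Ioc (0 : ℝ) 1, p t ∈ interior C' := fun t ht =>
    hconv.combo_self_interior_mem_interior hv hv0 (by linarith [ht.2]) ht.1 (by ring)
  -- `G` may be discontinuous at the relative boundary. Convexity along the segment to the interior
  -- point `v0` replaces continuity: only `l` has to pass to the limit `t → 0`.
  have hle : ∀ t ∈ Set.Ioc (0 : ℝ) 1, l (g (p t)) ≤ (1 - t) * G y + t * G (g v0) := by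
    intro t ht
    refine (hinter _ (hpint t ht)).trans ?_
    have hcomb : g (p t) = (1 - t) • g v + t • g v0 := by
      simp only [hg, p, Submodule.coe_add, Submodule.coe_smul]; module
    rw [hcomb, ← hgv]
    exact hG.2 (hmaps hv) (hmaps (interior_subset hv0)) (by linarith [ht.2]) ht.1.le (by ring)
  have hmem : ∀ᶠ t in 𝓝[>] (0 : ℝ), t ∈ Set.Ioc (0 : ℝ) 1 := Ioc_mem_nhdsGT one_pos
  have hlim1 : Tendsto (fun t => l (g (p t))) (𝓝[>] (0 : ℝ)) (𝓝 (l y)) := by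
    have h1 : ContinuousWithinAt (l ∘ g) C' (p 0) := by rw [hp0]; exact hlc v hv
    have h2 : Tendsto p (𝓝[>] (0 : ℝ)) (𝓝[C'] (p 0)) :=
      tendsto_nhdsWithin_iff.2 ⟨hpc.continuousAt.mono_left nhdsWithin_le_nhds,
        hmem.mono fun t ht => interior_subset (hpint t ht)⟩
    have := Tendsto.comp h1 h2
    simpa [hp0, hgv, Function.comp_def] using this
  have hlim2 : Tendsto (fun t : ℝ => (1 - t) * G y + t * G (g v0)) (𝓝[>] (0 : ℝ)) (𝓝 (G y)) := by
    have : Continuous (fun t : ℝ => (1 - t) * G y + t * G (g v0)) := by fun_prop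
    have := (this.tendsto 0).mono_left (nhdsWithin_le_nhds (s := Set.Ioi 0))
    simpa using this
  exact le_of_tendsto_of_tendsto hlim1 hlim2 (hmem.mono hle)

/-! ### Weak convexity and proximal maps in inner product spaces -/

section Prox

variable {E : Type*} [NormedAddCommGroup E] [InnerProductSpace ℝ E]

theorem norm_sq_convex_comb_sub (x y z : E) (t : ℝ) :
    ‖(1 - t) • x + t • y - z‖ ^ 2
      = (1 - t) * ‖x - z‖ ^ 2 + t * ‖y - z‖ ^ 2 - t * (1 - t) * ‖x - y‖ ^ 2 := by
  have h1 : (1 - t) • x + t • y - z = (1 - t) • (x - z) + t • (y - z) := by module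
  have h2 : x - y = (x - z) - (y - z) := by abel
  rw [h1, h2]
  simp only [← real_inner_self_eq_norm_sq, inner_add_left, inner_add_right, inner_sub_left (x - z),
    inner_sub_right _ (x - z), real_inner_smul_left, real_inner_smul_right]
  rw [real_inner_comm (x - z) (y - z)]
  ring

theorem norm_sq_convex_comb (x y : E) (t : ℝ) :
    ‖(1 - t) • x + t • y‖ ^ 2
      = (1 - t) * ‖x‖ ^ 2 + t * ‖y‖ ^ 2 - t * (1 - t) * ‖x - y‖ ^ 2 := by
  simpa using norm_sq_convex_comb_sub x y 0 t

theorem WeaklyConvexOn.segment_le {ρ : ℝ} {C : Set E} {h : E → ℝ} (hh : WeaklyConvexOn ρ C h)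
    {x y : E} (hx : x ∈ C) (hy : y ∈ C) {t : ℝ} (ht0 : 0 ≤ t) (ht1 : t ≤ 1) :
    h ((1 - t) • x + t • y) ≤ (1 - t) * h x + t * h y + ρ / 2 * (t * (1 - t)) * ‖x - y‖ ^ 2 := by
  have := hh.2 hx hy (by linarith : 0 ≤ 1 - t) ht0 (by ring)
  simp only [smul_eq_mul, norm_sq_convex_comb] at this
  linarith

theorem WeaklyConvexOn.of_segment_le {ρ : ℝ} {C : Set E} {h : E → ℝ} (hC : Convex ℝ C)
    (H : ∀ x ∈ C, ∀ y ∈ C, ∀ t : ℝ, 0 ≤ t → t ≤ 1 →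
      h ((1 - t) • x + t • y) ≤ (1 - t) * h x + t * h y + ρ / 2 * (t * (1 - t)) * ‖x - y‖ ^ 2) :
    WeaklyConvexOn ρ C h := by
  refine ⟨hC, fun x hx y hy a b ha hb hab => ?_⟩
  obtain rfl : a = 1 - b := by linarith
  have := H x hx y hy b hb (by linarith)
  simp only [smul_eq_mul, norm_sq_convex_comb]
  linarith

theorem Convex.one_sub_smul_add_smul_mem {C : Set E} (hC : Convex ℝ C) {x y : E} (hx : x ∈ C)
    (hy : y ∈ C) {t : ℝ} (ht0 : 0 ≤ t) (ht1 : t ≤ 1) : (1 - t) • x + t • y ∈ C :=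
  hC hx hy (by linarith) ht0 (by ring)

/-- The parameters `1 / (m + 1)` along which segments are tested. -/
noncomputable def segParam (m : ℕ) : ℝ := 1 / ((m : ℝ) + 1)

theorem segParam_pos (m : ℕ) : 0 < segParam m := by unfold segParam; positivity

theorem segParam_le_one (m : ℕ) : segParam m ≤ 1 := by
  unfold segParam
  rw [div_le_one (by positivity)]
  have : (0 : ℝ) ≤ m := by positivity
  linarith

/-- Quadratic growth at a minimizer `p` of `G + ‖· - x‖² / (2 a)`, from weak convexity and
minimality along the segment from `p` to `y`. -/
theorem quadratic_growth_of_segment {G : E → ℝ} {a η : ℝ} {x p y : E}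
    (hconv : ∀ m, G ((1 - segParam m) • p + segParam m • y) ≤ (1 - segParam m) * G p
      + segParam m * G y + η / 2 * (segParam m * (1 - segParam m)) * ‖p - y‖ ^ 2)
    (hmin : ∀ m, G p + 1 / (2 * a) * ‖p - x‖ ^ 2 ≤
      G ((1 - segParam m) • p + segParam m • y)
        + 1 / (2 * a) * ‖(1 - segParam m) • p + segParam m • y - x‖ ^ 2) :
    G p + 1 / (2 * a) * ‖p - x‖ ^ 2 + (1 / a - η) / 2 * ‖p - y‖ ^ 2
      ≤ G y + 1 / (2 * a) * ‖y - x‖ ^ 2 := by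
  have key : ∀ m, G p + 1 / (2 * a) * ‖p - x‖ ^ 2
      + (1 - segParam m) * ((1 / a - η) / 2 * ‖p - y‖ ^ 2)
      ≤ G y + 1 / (2 * a) * ‖y - x‖ ^ 2 := by
    intro m
    have h1 := hconv m
    have h2 := hmin m
    rw [norm_sq_convex_comb_sub] at h2
    have ht := segParam_pos m
    have h3 : 1 / (2 * a) = 1 / a / 2 := by rw [mul_comm, ← div_div]
    rw [h3] at h2 ⊢
    refine le_of_mul_le_mul_left ?_ ht
    nlinarith
  have hlim : Tendsto segParam atTop (𝓝 0) := tendsto_one_div_add_atTop_nhds_zero_nat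
  have : Tendsto (fun m => G p + 1 / (2 * a) * ‖p - x‖ ^ 2
      + (1 - segParam m) * ((1 / a - η) / 2 * ‖p - y‖ ^ 2)) atTop
      (𝓝 (G p + 1 / (2 * a) * ‖p - x‖ ^ 2 + (1 - 0) * ((1 / a - η) / 2 * ‖p - y‖ ^ 2))) :=
    ((hlim.const_sub 1).mul_const _).const_add _
  simpa using le_of_tendsto' this key

/-- `p` selects, for every `z`, a minimizer of `ψ + ‖· - z‖² / (2 θ)` over `C`. -/
def IsProxMap (θ : ℝ) (C : Set E) (ψ : E → ℝ) (p : E → E) : Prop :=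
  ∀ z, p z ∈ C ∧ ∀ y ∈ C, ψ (p z) + 1 / (2 * θ) * ‖p z - z‖ ^ 2 ≤ ψ y + 1 / (2 * θ) * ‖y - z‖ ^ 2

theorem exists_isProxMap [FiniteDimensional ℝ E] {θ b : ℝ} {C : Set E} {ψ : E → ℝ} (hθ : 0 < θ)
    (hC : IsClosed C) (hne : C.Nonempty) (hψ : ContinuousOn ψ C) (hb : ∀ y ∈ C, b ≤ ψ y) :
    ∃ p, IsProxMap θ C ψ p := by
  have : ∀ z, ∃ q ∈ C, IsMinOn (fun y => ψ y + 1 / (2 * θ) * ‖y - z‖ ^ 2) C q := by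
    intro z
    obtain ⟨c, hc⟩ := hne
    set A := ψ c + 1 / (2 * θ) * ‖c - z‖ ^ 2
    have hcont : ContinuousOn (fun y => ψ y + 1 / (2 * θ) * ‖y - z‖ ^ 2) C := by fun_prop
    refine hcont.exists_isMinOn' hC hc ?_
    rw [Filter.eventually_inf_principal]
    filter_upwards [(tendsto_norm_cocompact_atTop (E := E)).eventually_ge_atTop
      (‖z‖ + 1 + 2 * θ * |A - b|)] with y hy hyC
    have h1 : 1 + 2 * θ * |A - b| ≤ ‖y - z‖ := by linarith [norm_sub_norm_le y z]
    have h0 : 0 ≤ 2 * θ * |A - b| := by positivity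
    have h2 : 2 * θ * |A - b| ≤ ‖y - z‖ ^ 2 := by nlinarith
    have h3 : |A - b| ≤ 1 / (2 * θ) * ‖y - z‖ ^ 2 := by
      rw [one_div, ← div_eq_inv_mul, le_div_iff₀ (by positivity)]; linarith
    linarith [hb y hyC, le_abs_self (A - b)]
  choose p hp using this
  exact ⟨p, fun z => ⟨(hp z).1, fun y hy => (hp z).2 hy⟩⟩

variable {θ ρ : ℝ} {C : Set E} {ψ : E → ℝ} {p : E → E}

theorem IsProxMap.quadratic_growth (hp : IsProxMap θ C ψ p) (hψ : WeaklyConvexOn ρ C ψ)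
    (z : E) {y : E} (hy : y ∈ C) :
    ψ (p z) + 1 / (2 * θ) * ‖p z - z‖ ^ 2 + (1 / θ - ρ) / 2 * ‖p z - y‖ ^ 2
      ≤ ψ y + 1 / (2 * θ) * ‖y - z‖ ^ 2 :=
  quadratic_growth_of_segment
    (fun m => hψ.segment_le (hp z).1 hy (segParam_pos m).le (segParam_le_one m))
    (fun m => (hp z).2 _ (hψ.1.one_sub_smul_add_smul_mem (hp z).1 hy (segParam_pos m).le
      (segParam_le_one m)))

/-- Adding the growth inequality at `z` tested with `p w` to the one at `w` tested with `p z`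
cancels the values of `ψ` and leaves `(1/θ - ρ)‖p z - p w‖² ≤ (1/θ)⟪p z - p w, z - w⟫`. -/
theorem IsProxMap.norm_sub_le (hp : IsProxMap θ C ψ p) (hψ : WeaklyConvexOn ρ C ψ) (hθ : 0 < θ)
    (hρ : 0 < 1 / θ - ρ) (z w : E) :
    ‖p z - p w‖ ≤ 1 / (θ * (1 / θ - ρ)) * ‖z - w‖ := by
  have h1 := hp.quadratic_growth hψ z (hp w).1
  have h2 := hp.quadratic_growth hψ w (hp z).1
  have h3 : ‖p w - z‖ ^ 2 - ‖p z - z‖ ^ 2 + (‖p z - w‖ ^ 2 - ‖p w - w‖ ^ 2)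
      = 2 * inner ℝ (p z - p w) (z - w) := by
    simp only [← real_inner_self_eq_norm_sq, inner_sub_left, inner_sub_right]
    rw [real_inner_comm (p w) z, real_inner_comm (p z) z, real_inner_comm (p z) w,
      real_inner_comm (p w) w]
    ring
  have h4 := real_inner_le_norm (p z - p w) (z - w)
  rw [norm_sub_rev (p w) (p z)] at h2
  have h5 : (1 / θ - ρ) * ‖p z - p w‖ ^ 2 ≤ 1 / θ * (‖p z - p w‖ * ‖z - w‖) := by
    have h6 : 0 < 1 / θ := by positivity
    have h7 : 1 / (2 * θ) = 1 / θ / 2 := by rw [mul_comm, ← div_div]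
    rw [h7] at h1 h2
    have := mul_le_mul_of_nonneg_left h4 h6.le
    have := congrArg (fun r => 1 / θ / 2 * r) h3
    nlinarith
  rcases (norm_nonneg (p z - p w)).eq_or_lt with h0 | h0
  · rw [← h0]; positivity
  · have h8 : (1 / θ - ρ) * ‖p z - p w‖ ≤ 1 / θ * ‖z - w‖ := by
      refine le_of_mul_le_mul_left ?_ h0
      nlinarith
    have h9 : 1 / (θ * (1 / θ - ρ)) * ‖z - w‖ = (1 / θ * ‖z - w‖) / (1 / θ - ρ) := by
      field_simp
    rw [h9, le_div_iff₀ hρ]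
    linarith

theorem IsProxMap.continuous (hp : IsProxMap θ C ψ p) (hψ : WeaklyConvexOn ρ C ψ) (hθ : 0 < θ)
    (hρ : 0 < 1 / θ - ρ) : Continuous p := by
  have hK : 0 ≤ 1 / (θ * (1 / θ - ρ)) := by positivity
  refine (LipschitzWith.of_dist_le_mul (K := ⟨_, hK⟩) fun z w => ?_).continuous
  rw [dist_eq_norm, dist_eq_norm]
  exact hp.norm_sub_le hψ hθ hρ z w

/-- The Moreau envelope of a proximal map. -/
noncomputable def proxEnv (θ : ℝ) (ψ : E → ℝ) (p : E → E) (z : E) : ℝ :=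
  ψ (p z) + 1 / (2 * θ) * ‖p z - z‖ ^ 2

/-- The point `p z` is a candidate in the minimization at `w`; expanding the square gives the bound.
No convexity is needed. -/
theorem IsProxMap.proxEnv_sub_le (hp : IsProxMap θ C ψ p) (z w : E) :
    proxEnv θ ψ p w ≤ proxEnv θ ψ p z + 1 / θ * inner ℝ (z - p z) (w - z)
      + 1 / (2 * θ) * ‖w - z‖ ^ 2 := by
  have h1 := (hp w).2 (p z) (hp z).1
  have h2 : ‖p z - w‖ ^ 2 = ‖p z - z‖ ^ 2 + 2 * inner ℝ (z - p z) (w - z) + ‖w - z‖ ^ 2 := by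
    have : p z - w = -((z - p z) + (w - z)) := by abel
    rw [this, norm_neg, norm_add_sq_real, norm_sub_rev z]
  have h7 : 1 / (2 * θ) = 1 / θ / 2 := by rw [mul_comm, ← div_div]
  unfold proxEnv
  rw [h2] at h1
  rw [h7] at h1 ⊢
  linarith

theorem IsProxMap.hasGradientAt [CompleteSpace E] (hp : IsProxMap θ C ψ p)
    (hψ : WeaklyConvexOn ρ C ψ) (hθ : 0 < θ) (hρ : 0 < 1 / θ - ρ) (z : E) :
    HasGradientAt (proxEnv θ ψ p) ((1 / θ) • (z - p z)) z := by
  rw [hasGradientAt_iff_isLittleO]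
  set K := 1 / (θ * (1 / θ - ρ))
  have hK : 0 ≤ K := by positivity
  -- The upper bound is `proxEnv_sub_le`. The lower bound is the same inequality with `z` and `w`
  -- exchanged, where replacing `p w` by `p z` costs `O(‖w - z‖²)` since `p` is Lipschitz.
  have hbound : ∀ w, ‖proxEnv θ ψ p w - proxEnv θ ψ p z - inner ℝ ((1 / θ) • (z - p z)) (w - z)‖
      ≤ (1 / θ * (2 + K)) * (‖w - z‖ * ‖w - z‖) := by
    intro w
    have h1 := hp.proxEnv_sub_le z w
    have h2 := hp.proxEnv_sub_le w z
    have h3 : inner ℝ (w - p w) (z - w)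
        = - inner ℝ (z - p z) (w - z) - ‖w - z‖ ^ 2 + inner ℝ (p w - p z) (w - z) := by
      have e1 : z - w = -(w - z) := by abel
      have e2 : w - p w = (z - p z) + (w - z) - (p w - p z) := by abel
      rw [e1, e2, inner_neg_right, inner_sub_left, inner_add_left, real_inner_self_eq_norm_sq]
      ring
    have h4 : inner ℝ (p w - p z) (w - z) ≤ K * (‖w - z‖ * ‖w - z‖) := by
      refine (real_inner_le_norm _ _).trans ?_
      have := mul_le_mul_of_nonneg_right (hp.norm_sub_le hψ hθ hρ w z) (norm_nonneg (w - z))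
      linarith
    rw [h3, norm_sub_rev z w] at h2
    have h6 : 0 < 1 / θ := by positivity
    have h7 : 1 / (2 * θ) = 1 / θ / 2 := by rw [mul_comm, ← div_div]
    rw [h7] at h1 h2
    rw [real_inner_smul_left, Real.norm_eq_abs, abs_le]
    have h8 := mul_le_mul_of_nonneg_left h4 h6.le
    have h9 : 0 ≤ 1 / θ * (‖w - z‖ * ‖w - z‖) := by positivity
    have h10 : 0 ≤ 1 / θ * (K * (‖w - z‖ * ‖w - z‖)) := by positivity
    constructor <;> nlinarith
  refine (Asymptotics.IsBigO.of_bound (1 / θ * (2 + K)) (g := fun w => ‖w - z‖ * ‖w - z‖)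
    (Eventually.of_forall fun w => ?_)).trans_isLittleO ?_
  · rw [Real.norm_of_nonneg (by positivity : 0 ≤ ‖w - z‖ * ‖w - z‖)]
    exact hbound w
  · have h0 : Tendsto (fun w => ‖w - z‖) (𝓝 z) (𝓝 0) := by
      have : Continuous fun w => ‖w - z‖ := by fun_prop
      simpa using this.tendsto z
    have h1 : (fun w => ‖w - z‖) =o[𝓝 z] (fun _ => (1 : ℝ)) :=
      (Asymptotics.isLittleO_one_iff ℝ).2 h0
    have h2 := h1.mul_isBigO (Asymptotics.isBigO_refl (fun w => ‖w - z‖) (𝓝 z))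
    simp only [one_mul] at h2
    exact h2.trans_isBigO (Asymptotics.isBigO_refl _ _).norm_left

end Prox

/-! ### Extended-real-valued functions -/

section ExtendedReal

variable {E : Type*}

theorem coe_toReal_of_mem_effDom {h : E → EReal} (hb : ∀ x, h x ≠ ⊥) {x : E} (hx : x ∈ effDom h) :
    ((h x).toReal : EReal) = h x :=
  EReal.coe_toReal (ne_of_lt hx) (hb x)

theorem eq_top_of_notMem_effDom {h : E → EReal} {x : E} (hx : x ∉ effDom h) : h x = ⊤ := by
  simpa [effDom] using hx

theorem coe_add_ne_bot {h : E → EReal} (hb : ∀ x, h x ≠ ⊥) (c : E → ℝ) (x : E) :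
    (c x : EReal) + h x ≠ ⊥ := by
  simp [EReal.add_eq_bot_iff, hb x]

theorem effDom_coe_add {h : E → EReal} (c : E → ℝ) :
    effDom (fun y => (c y : EReal) + h y) = effDom h := by
  ext x
  simp only [effDom, Set.mem_ofPred_eq]
  constructor
  · intro hx
    by_contra hcon
    rw [not_lt_top_iff.1 hcon] at hx
    simp at hx
  · intro hx
    exact EReal.add_lt_top (EReal.coe_ne_top _) hx.ne

theorem toReal_coe_add {h : E → EReal} (hb : ∀ x, h x ≠ ⊥) (c : E → ℝ) {x : E}
    (hx : x ∈ effDom h) : ((c x : EReal) + h x).toReal = c x + (h x).toReal := by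
  rw [EReal.toReal_add (EReal.coe_ne_top _) (EReal.coe_ne_bot _) (ne_of_lt hx) (hb x),
    EReal.toReal_coe]

theorem proxObjective_eq_coe [NormedAddCommGroup E] {h : E → EReal} (hb : ∀ x, h x ≠ ⊥)
    (t : ℝ) (z : E) {y : E} (hy : y ∈ effDom h) :
    proxObjective t h z y = (((h y).toReal + 1 / (2 * t) * ‖y - z‖ ^ 2 : ℝ) : EReal) := by
  rw [proxObjective, EReal.coe_add, coe_toReal_of_mem_effDom hb hy]

theorem isMinOn_proxObjective_iff [NormedAddCommGroup E] {h : E → EReal} (hb : ∀ x, h x ≠ ⊥)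
    (hne : (effDom h).Nonempty) (t : ℝ) (z y : E) :
    IsMinOn (proxObjective t h z) Set.univ y ↔ y ∈ effDom h ∧ ∀ w ∈ effDom h,
      (h y).toReal + 1 / (2 * t) * ‖y - z‖ ^ 2 ≤ (h w).toReal + 1 / (2 * t) * ‖w - z‖ ^ 2 := by
  rw [isMinOn_iff]
  constructor
  · intro H
    have hy : y ∈ effDom h := by
      obtain ⟨c, hc⟩ := hne
      have := H c (Set.mem_univ _)
      by_contra hcon
      rw [proxObjective_eq_coe hb t z hc, proxObjective, eq_top_of_notMem_effDom hcon,
        EReal.top_add_coe, top_le_iff] at this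
      exact EReal.coe_ne_top _ this
    refine ⟨hy, fun w hw => ?_⟩
    have := H w (Set.mem_univ _)
    rw [proxObjective_eq_coe hb t z hw, proxObjective_eq_coe hb t z hy] at this
    exact EReal.coe_le_coe_iff.1 this
  · rintro ⟨hy, H⟩ w -
    by_cases hw : w ∈ effDom h
    · rw [proxObjective_eq_coe hb t z hw, proxObjective_eq_coe hb t z hy]
      exact EReal.coe_le_coe_iff.2 (H w hw)
    · rw [proxObjective.eq_def t h z w, eq_top_of_notMem_effDom hw, EReal.top_add_coe]
      exact le_top

theorem IsProxMap.isMinOn_proxObjective [NormedAddCommGroup E] [InnerProductSpace ℝ E]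
    {h : E → EReal} (hb : ∀ x, h x ≠ ⊥) {θ : ℝ} {p : E → E}
    (hp : IsProxMap θ (effDom h) (fun x => (h x).toReal) p) (z : E) :
    IsMinOn (proxObjective θ h z) Set.univ (p z) :=
  (isMinOn_proxObjective_iff hb ⟨_, (hp z).1⟩ θ z (p z)).2 (hp z)

theorem IsProxMap.proxObjective_eq [NormedAddCommGroup E] [InnerProductSpace ℝ E]
    {h : E → EReal} (hb : ∀ x, h x ≠ ⊥) {θ : ℝ} {p : E → E}
    (hp : IsProxMap θ (effDom h) (fun x => (h x).toReal) p) (z : E) :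
    proxObjective θ h z (p z) = (proxEnv θ (fun x => (h x).toReal) p z : EReal) :=
  proxObjective_eq_coe hb θ z (hp z).1

theorem IsProxMap.moreauEnv_eq [NormedAddCommGroup E] [InnerProductSpace ℝ E]
    {h : E → EReal} (hb : ∀ x, h x ≠ ⊥) {θ : ℝ} {p : E → E}
    (hp : IsProxMap θ (effDom h) (fun x => (h x).toReal) p) :
    moreauEnv θ h = proxEnv θ (fun x => (h x).toReal) p := by
  ext z
  have : ⨅ y, proxObjective θ h z y = proxObjective θ h z (p z) :=
    le_antisymm (iInf_le _ _)
      (le_iInf fun y => isMinOn_iff.1 (hp.isMinOn_proxObjective hb z) y (Set.mem_univ _))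
  rw [moreauEnv, this, hp.proxObjective_eq hb, EReal.toReal_coe]

/-- A lower semicontinuous function that is Lipschitz on its domain has a closed domain. -/
theorem isClosed_effDom [NormedAddCommGroup E] {h : E → EReal} (hb : ∀ x, h x ≠ ⊥)
    (hlsc : LowerSemicontinuous h) {K : ℝ≥0}
    (hK : LipschitzOnWith K (fun x => (h x).toReal) (effDom h)) : IsClosed (effDom h) := by
  refine isClosed_of_closure_subset fun x hx => ?_
  by_contra hcon
  obtain ⟨y0, hy0, hd0⟩ := Metric.mem_closure_iff.1 hx 1 one_pos
  -- At a limit point outside the domain the value is `⊤`, so nearby values exceed any bound; domain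
  -- points within distance 2 of `y0` cannot exceed `h y0 + 2K`.
  have hev : ∀ᶠ y in 𝓝 x, (((h y0).toReal + K * 2 : ℝ) : EReal) < h y :=
    hlsc x _ (show _ < h x by rw [eq_top_of_notMem_effDom hcon]; exact EReal.coe_lt_top _)
  obtain ⟨ε, hε, hball⟩ := Metric.eventually_nhds_iff.1 hev
  obtain ⟨y, hy, hd⟩ := Metric.mem_closure_iff.1 hx (min ε 1) (lt_min hε one_pos)
  have h1 := hball (y := y) (by rw [dist_comm]; exact hd.trans_le (min_le_left _ _))
  rw [← coe_toReal_of_mem_effDom hb hy, EReal.coe_lt_coe_iff] at h1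
  have h2 := hK.dist_le_mul y hy y0 hy0
  rw [Real.dist_eq] at h2
  have h3 : dist y y0 ≤ 2 := by
    have := dist_triangle_left y y0 x
    linarith [hd.trans_le (min_le_right _ _)]
  have h4 : (K : ℝ) * dist y y0 ≤ K * 2 := mul_le_mul_of_nonneg_left h3 K.2
  linarith [le_abs_self ((h y).toReal - (h y0).toReal)]

end ExtendedReal

/-! ### Independent sampling -/

section Sampling

variable {Ω Ξ : Type*} [MeasurableSpace Ξ]

/-- The first `k` samples. -/
def samplePrefix (ξ : ℕ → Ω → Ξ) (k : ℕ) (ω : Ω) (i : Finset.range k) : Ξ := ξ i ω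

theorem sampleHistory_eq_comap (ξ : ℕ → Ω → Ξ) (k : ℕ) :
    sampleHistory ξ k = MeasurableSpace.comap (samplePrefix ξ k) inferInstance := by
  rw [sampleHistory, MeasurableSpace.pi, MeasurableSpace.comap_iSup]
  simp only [MeasurableSpace.comap_comp]
  refine le_antisymm (iSup_le fun i => ?_) (iSup_le fun i => ?_)
  · exact le_iSup (fun i : Finset.range k => MeasurableSpace.comap
      ((fun f : Finset.range k → Ξ => f i) ∘ samplePrefix ξ k) inferInstance)
      ⟨i, Finset.mem_range.2 i.2⟩
  · exact le_iSup (fun i : Fin k => MeasurableSpace.comap (ξ i) inferInstance)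
      ⟨i, Finset.mem_range.1 i.2⟩

/-- Splitting off the last sample presents `xᵏ⁺¹` as a measurable function of the prefix and of
`ξᵏ`, which are independent. -/
theorem sampleHistory_succ_eq_comap (ξ : ℕ → Ω → Ξ) (k : ℕ) :
    sampleHistory ξ (k + 1)
      = MeasurableSpace.comap (fun ω => (samplePrefix ξ k ω, ξ k ω)) inferInstance := by
  have h : (MeasurableSpace.comap (fun ω => (samplePrefix ξ k ω, ξ k ω)) inferInstance)
      = sampleHistory ξ k ⊔ MeasurableSpace.comap (ξ k) inferInstance := by
    rw [sampleHistory_eq_comap]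
    exact MeasurableSpace.comap_prodMk _ _
  rw [h]
  refine le_antisymm (iSup_le fun i => ?_) (sup_le (iSup_le fun i => ?_) ?_)
  · rcases (Nat.lt_succ_iff.1 i.2).lt_or_eq with hi | hi
    · exact (le_iSup (fun i : Fin k => MeasurableSpace.comap (ξ i) inferInstance)
        ⟨i, hi⟩).trans le_sup_left
    · rw [hi]; exact le_sup_right
  · exact le_iSup (fun i : Fin (k + 1) => MeasurableSpace.comap (ξ i) inferInstance) i.castSucc
  · exact le_iSup (fun i : Fin (k + 1) => MeasurableSpace.comap (ξ i) inferInstance) (Fin.last k)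

variable [MeasurableSpace Ω] {P : Measure Ω} {D : Measure Ξ}

theorem measurable_samplePrefix {ξ : ℕ → Ω → Ξ} (hξ : ∀ k, Measurable (ξ k)) (k : ℕ) :
    Measurable (samplePrefix ξ k) :=
  measurable_pi_lambda _ fun i => hξ i

theorem sampleHistory_le {ξ : ℕ → Ω → Ξ} (hξ : ∀ k, Measurable (ξ k)) (k : ℕ) :
    sampleHistory ξ k ≤ (inferInstance : MeasurableSpace Ω) :=
  iSup_le fun i => (hξ i).comap_le

theorem indepFun_samplePrefix {ξ : ℕ → Ω → Ξ} (hξ : ∀ k, Measurable (ξ k))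
    (hindep : iIndepFun ξ P) (k : ℕ) : IndepFun (samplePrefix ξ k) (ξ k) P := by
  have h := hindep.indepFun_finset (Finset.range k) {k} (by simp) hξ
  exact h.comp (φ := id) (ψ := fun f : ({k} : Finset ℕ) → Ξ => f ⟨k, by simp⟩) measurable_id
    (measurable_pi_apply _)

theorem map_prodMk_eq_prod [IsProbabilityMeasure P] {H : Type*} [MeasurableSpace H] {h : Ω → H} {s : Ω → Ξ}
    (hh : Measurable h) (hs : Measurable s) (hindep : IndepFun h s P) (hlaw : P.map s = D) :
    P.map (fun ω => (h ω, s ω)) = (P.map h).prod D := by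
  rw [(indepFun_iff_map_prod_eq_prod_map_map hh.aemeasurable hs.aemeasurable).1 hindep, hlaw]

variable [IsProbabilityMeasure P] [IsProbabilityMeasure D]
  {E : Type*} [TopologicalSpace E] [PolishSpace E] [MeasurableSpace E] [BorelSpace E]
  [Nonempty E]

/-- If a measurable relation holds for every `x ∈ U` and almost every sample, uniformly in `y ∈ C`,
then it holds almost surely along the iterates of an adapted process. -/
theorem ae_mem_of_forall_ae {ξ : ℕ → Ω → Ξ} (hξ : ∀ k, Measurable (ξ k)) (hindep : iIndepFun ξ P)
    (hlaw : ∀ k, P.map (ξ k) = D) {x : ℕ → Ω → E} (hx : ∀ k, Measurable[sampleHistory ξ k] (x k))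
    {U C : Set E} (hU : MeasurableSet U) (hC : MeasurableSet C)
    {Q : Set (E × E × Ξ)} (hQ : MeasurableSet Q)
    (H : ∀ a ∈ U, ∀ᵐ s ∂D, ∀ b ∈ C, (a, b, s) ∈ Q) (k : ℕ) :
    ∀ᵐ ω ∂P, x k ω ∈ U → x (k + 1) ω ∈ C → (x k ω, x (k + 1) ω, ξ k ω) ∈ Q := by
  have h1 := hx k
  have h2 := hx (k + 1)
  rw [sampleHistory_eq_comap] at h1
  rw [sampleHistory_succ_eq_comap] at h2
  obtain ⟨X, hX, hXe⟩ := h1.exists_eq_measurable_comp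
  obtain ⟨G, hG, hGe⟩ := h2.exists_eq_measurable_comp
  have hpre := measurable_samplePrefix hξ k
  set R : Set ((Finset.range k → Ξ) × Ξ) :=
    {q | X q.1 ∈ U → G q ∈ C → (X q.1, G q, q.2) ∈ Q} with hR
  have hRm : MeasurableSet R := by
    have m1 : MeasurableSet {q : (Finset.range k → Ξ) × Ξ | X q.1 ∈ U} := (hX.comp measurable_fst) hU
    have m2 : MeasurableSet {q : (Finset.range k → Ξ) × Ξ | G q ∈ C} := hG hC
    have m3 : MeasurableSet {q : (Finset.range k → Ξ) × Ξ | (X q.1, G q, q.2) ∈ Q} :=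
      ((hX.comp measurable_fst).prodMk (hG.prodMk measurable_snd)) hQ
    exact m1.imp (m2.imp m3)
  -- With the prefix frozen, `xᵏ` is a fixed point of the space. The next iterate still varies with
  -- `s`, which is why the assumption must be uniform in `b ∈ C` for almost every `s`.
  have hae : ∀ᵐ q ∂(P.map (samplePrefix ξ k)).prod D, q ∈ R := by
    refine (Measure.ae_prod_iff_ae_ae hRm).2 ?_
    refine Eventually.of_forall fun a => ?_
    by_cases ha : X a ∈ U
    · filter_upwards [H _ ha] with s hs
      exact fun _ hb => hs _ hb
    · exact Eventually.of_forall fun s hs => absurd hs ha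
  rw [← map_prodMk_eq_prod hpre (hξ k) (indepFun_samplePrefix hξ hindep k) (hlaw k)] at hae
  filter_upwards [ae_of_ae_map (hpre.prodMk (hξ k)).aemeasurable hae] with ω hω
  have e1 : x k ω = X (samplePrefix ξ k ω) := congrFun hXe ω
  have e2 : x (k + 1) ω = G (samplePrefix ξ k ω, ξ k ω) := congrFun hGe ω
  rw [e1, e2]
  exact hω

/-- Integration of a function of the current iterate and of the fresh sample: a bound for the
conditional expectation integrates to a bound for the expectation. -/
theorem integrable_and_integral_le_of_sample {ξ : ℕ → Ω → Ξ} (hξ : ∀ k, Measurable (ξ k))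
    (hindep : iIndepFun ξ P) (hlaw : ∀ k, P.map (ξ k) = D) {x : ℕ → Ω → E}
    (hx : ∀ k, Measurable[sampleHistory ξ k] (x k)) {C : Set E} (hC : MeasurableSet C)
    {T : E × Ξ → ℝ} (hT : Measurable T) {B : E → ℝ} (hB : Measurable B)
    (hT0 : ∀ a ∈ C, ∀ᵐ s ∂D, 0 ≤ T (a, s)) (hTi : ∀ a ∈ C, Integrable (fun s => T (a, s)) D)
    (hTB : ∀ a ∈ C, ∫ s, T (a, s) ∂D ≤ B a) (k : ℕ) (hxC : ∀ᵐ ω ∂P, x k ω ∈ C)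
    (hBi : Integrable (fun ω => B (x k ω)) P) :
    Integrable (fun ω => T (x k ω, ξ k ω)) P ∧
      ∫ ω, T (x k ω, ξ k ω) ∂P ≤ ∫ ω, B (x k ω) ∂P := by
  have hxm : Measurable (x k) := (hx k).mono (sampleHistory_le hξ k) le_rfl
  have hind : IndepFun (x k) (ξ k) P := by
    have h1 := hx k
    rw [sampleHistory_eq_comap] at h1
    obtain ⟨X, hX, hXe⟩ := h1.exists_eq_measurable_comp
    rw [hXe]
    exact (indepFun_samplePrefix hξ hindep k).comp hX measurable_id
  have hmap := map_prodMk_eq_prod hxm (hξ k) hind (hlaw k)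
  set μ := P.map (x k)
  have : IsProbabilityMeasure μ := Measure.isProbabilityMeasure_map hxm.aemeasurable
  have hC' : ∀ᵐ a ∂μ, a ∈ C := (ae_map_iff hxm.aemeasurable hC).2 hxC
  have hBμ : Integrable B μ := (integrable_map_measure hB.aestronglyMeasurable
    hxm.aemeasurable).2 hBi
  have hnorm : ∀ᵐ a ∂μ, ∫ s, ‖T (a, s)‖ ∂D = ∫ s, T (a, s) ∂D := by
    filter_upwards [hC'] with a ha
    refine integral_congr_ae ?_
    filter_upwards [hT0 a ha] with s hs
    exact Real.norm_of_nonneg hs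
  -- Nonnegativity of `T` identifies its fibrewise `L¹` norm with its fibrewise mean, so the
  -- one-sided bound `B` already gives integrability on the product.
  have hTp : Integrable T (μ.prod D) := by
    rw [integrable_prod_iff hT.aestronglyMeasurable]
    refine ⟨hC'.mono fun a ha => hTi a ha, ?_⟩
    refine hBμ.mono' hT.norm.aestronglyMeasurable.integral_prod_right' ?_
    filter_upwards [hC', hnorm] with a ha hn
    rw [Real.norm_of_nonneg (integral_nonneg fun s => norm_nonneg _), hn]
    exact hTB a ha
  have hpm : Measurable fun ω => (x k ω, ξ k ω) := hxm.prodMk (hξ k)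
  constructor
  · rw [← hmap] at hTp
    exact hTp.comp_measurable hpm
  · calc ∫ ω, T (x k ω, ξ k ω) ∂P = ∫ q, T q ∂(μ.prod D) := by
          rw [← hmap, integral_map hpm.aemeasurable hT.aestronglyMeasurable]
      _ = ∫ a, ∫ s, T (a, s) ∂D ∂μ := integral_prod _ hTp
      _ ≤ ∫ a, B a ∂μ := integral_mono_ae hTp.integral_prod_left hBμ (hC'.mono fun a ha => hTB a ha)
      _ = ∫ ω, B (x k ω) ∂P := integral_map hxm.aemeasurable hB.aestronglyMeasurable

end Sampling

/-- A function on `U × U × Ξ`, extended by zero. -/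
noncomputable def extendZero {E Ξ : Type*} (U : Set E) (M : E → E → Ξ → ℝ) (q : E × E × Ξ) : ℝ :=
  open Classical in if q.1 ∈ U ∧ q.2.1 ∈ U then M q.1 q.2.1 q.2.2 else 0

theorem extendZero_apply {E Ξ : Type*} {U : Set E} (M : E → E → Ξ → ℝ) {x y : E} (hx : x ∈ U)
    (hy : y ∈ U) (s : Ξ) : extendZero U M (x, y, s) = M x y s := by
  simp [extendZero, hx, hy]

theorem measurable_extendZero {E Ξ : Type*} [MeasurableSpace E] [MeasurableSpace Ξ] {U : Set E}
    (hU : MeasurableSet U) {M : E → E → Ξ → ℝ}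
    (hM : Measurable (fun p : U × U × Ξ => M p.1 p.2.1 p.2.2)) : Measurable (extendZero U M) := by
  have hS : MeasurableSet {q : E × E × Ξ | q.1 ∈ U ∧ q.2.1 ∈ U} :=
    (measurable_fst hU).inter ((measurable_fst.comp measurable_snd) hU)
  refine measurable_of_restrict_of_restrict_compl hS ?_ ?_
  · let j : {q : E × E × Ξ | q.1 ∈ U ∧ q.2.1 ∈ U} → U × U × Ξ :=
      fun q => (⟨q.1.1, q.2.1⟩, ⟨q.1.2.1, q.2.2⟩, q.1.2.2)
    have hj : Measurable j := by
      refine Measurable.prodMk ?_ (Measurable.prodMk ?_ ?_)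
      · exact (measurable_fst.comp measurable_subtype_coe).subtype_mk
      · exact ((measurable_fst.comp measurable_snd).comp measurable_subtype_coe).subtype_mk
      · exact (measurable_snd.comp measurable_snd).comp measurable_subtype_coe
    convert hM.comp hj using 1
    ext q
    exact extendZero_apply M q.2.1 q.2.2 _
  · convert measurable_const (a := (0 : ℝ)) using 1
    ext q
    exact if_neg q.2

/-! ### The stochastic model-based method, in terms of real-valued functions -/

/-- The stochastic model-based method for `f + φ` over the closed convex set `C`, with models
`M x y s`, steps `α`, samples `ξ` and iterates `x`. -/
structure IsModelMethod {E Ξ Ω : Type*} [NormedAddCommGroup E] [InnerProductSpace ℝ E]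
    [MeasurableSpace E] [MeasurableSpace Ξ] [MeasurableSpace Ω] (D : Measure Ξ) (P : Measure Ω)
    (U C : Set E) (f φ : E → ℝ) (M : E → E → Ξ → ℝ) (τ η L : ℝ) (Lφ : ℝ≥0)
    (α : ℕ → ℝ) (ξ : ℕ → Ω → Ξ) (x : ℕ → Ω → E) : Prop where
  isOpen : IsOpen U
  subset : C ⊆ U
  isClosed : IsClosed C
  convex : Convex ℝ C
  nonempty : C.Nonempty
  measurable_reg : Measurable φ
  lipschitz_reg : LipschitzOnWith Lφ φ C
  measurable_model : Measurable (fun p : U × U × Ξ => M p.1 p.2.1 p.2.2)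
  integrable_model : ∀ x ∈ U, ∀ y ∈ U, Integrable (M x y) D
  model_self : ∀ x ∈ U, ∫ s, M x x s ∂D = f x
  model_le : ∀ x ∈ U, ∀ y ∈ U, ∫ s, M x y s ∂D ≤ f y + τ / 2 * ‖x - y‖ ^ 2
  model_weaklyConvex : ∀ x ∈ U, ∀ᵐ s ∂D, WeaklyConvexOn η C (fun y => M x y s + φ y)
  lip_pos : 0 < L
  model_lip : ∀ x ∈ U, ∀ y ∈ U, ∀ᵐ s ∂D, M x x s - M x y s ≤ L * ‖x - y‖
  step_pos : ∀ k, 0 < α k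
  measurable_sample : ∀ k, Measurable (ξ k)
  indep : iIndepFun ξ P
  law : ∀ k, P.map (ξ k) = D
  adapted : ∀ k, Measurable[sampleHistory ξ k] (x k)
  init_mem : ∀ ω, x 0 ω ∈ U
  step : ∀ k, ∀ᵐ ω ∂P, x (k + 1) ω ∈ C ∧ ∀ y ∈ C,
    M (x k ω) (x (k + 1) ω) (ξ k ω) + φ (x (k + 1) ω)
        + 1 / (2 * α k) * ‖x (k + 1) ω - x k ω‖ ^ 2
      ≤ M (x k ω) y (ξ k ω) + φ y + 1 / (2 * α k) * ‖y - x k ω‖ ^ 2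

/-! ### Integrals of squares and almost sure summability -/

theorem integrable_norm_sq_sub {E Ω : Type*} [NormedAddCommGroup E] [MeasurableSpace Ω]
    {P : Measure Ω} {u v : Ω → E} (hu : MemLp u 2 P) (hv : MemLp v 2 P) :
    Integrable (fun ω => ‖u ω - v ω‖ ^ 2) P :=
  (memLp_two_iff_integrable_sq_norm (hu.sub hv).aestronglyMeasurable).1 (hu.sub hv)

theorem integrable_norm_sub {E Ω : Type*} [NormedAddCommGroup E] [MeasurableSpace Ω]
    {P : Measure Ω} [IsFiniteMeasure P] {u v : Ω → E} (hu : MemLp u 2 P) (hv : MemLp v 2 P) :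
    Integrable (fun ω => ‖u ω - v ω‖) P :=
  ((hu.sub hv).integrable (by norm_num)).norm

/-- The variance `∫ (g - m)²` is nonnegative. -/
theorem sq_integral_le_integral_sq {Ω : Type*} [MeasurableSpace Ω] {P : Measure Ω}
    [IsProbabilityMeasure P] {g : Ω → ℝ} (hg : Integrable g P)
    (hg2 : Integrable (fun ω => g ω ^ 2) P) : (∫ ω, g ω ∂P) ^ 2 ≤ ∫ ω, g ω ^ 2 ∂P := by
  set m := ∫ ω, g ω ∂P with hm
  have h : 0 ≤ ∫ ω, (g ω ^ 2 - 2 * m * g ω + m ^ 2) ∂P :=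
    integral_nonneg fun ω => by
      have : g ω ^ 2 - 2 * m * g ω + m ^ 2 = (g ω - m) ^ 2 := by ring
      rw [this]; positivity
  have hg' := hg.const_mul (2 * m)
  rw [integral_add (f := fun ω => g ω ^ 2 - 2 * m * g ω) (hg2.sub hg') (integrable_const _),
    integral_sub hg2 hg', integral_const_mul, ← hm] at h
  simp at h
  nlinarith

theorem ae_summable_of_summable_integral {Ω : Type*} [MeasurableSpace Ω] {P : Measure Ω}
    {g : ℕ → Ω → ℝ} (hg : ∀ k, Integrable (g k) P) (h0 : ∀ k ω, 0 ≤ g k ω)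
    (hs : Summable fun k => ∫ ω, g k ω ∂P) : ∀ᵐ ω ∂P, Summable fun k => g k ω := by
  have hm : ∀ k, AEMeasurable (fun ω => ENNReal.ofReal (g k ω)) P :=
    fun k => (hg k).aestronglyMeasurable.aemeasurable.ennreal_ofReal
  have h1 : ∫⁻ ω, ∑' k, ENNReal.ofReal (g k ω) ∂P ≠ ⊤ := by
    rw [lintegral_tsum hm]
    have : ∀ k, ∫⁻ ω, ENNReal.ofReal (g k ω) ∂P = ENNReal.ofReal (∫ ω, g k ω ∂P) := fun k =>
      (ofReal_integral_eq_lintegral_ofReal (hg k) (Eventually.of_forall (h0 k))).symm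
    simp only [this]
    exact hs.tsum_ofReal_ne_top
  filter_upwards [ae_lt_top' (AEMeasurable.tsum hm) h1] with ω hω
  have := ENNReal.summable_toReal hω.ne
  simpa [ENNReal.toReal_ofReal (h0 _ ω)] using this

/-- The increment bound is only required from index 1 on, because `x⁰` lies in `U` but possibly not
in `C`, so the first step need not be `O(α₀)`. -/
theorem tendsto_zero_of_summable_mul_sq_succ {α w : ℕ → ℝ} {C : ℝ} (hα : ∀ k, 0 < α k)
    (hw : ∀ k, 0 ≤ w k)
    (hα_sum : Tendsto (fun K => ∑ k ∈ Finset.range K, α k) atTop atTop)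
    (hα_sq : Summable (fun k => α k ^ 2))
    (hsum : Summable (fun k => α k * w k ^ 2))
    (hinc : ∀ k, |w (k + 2) - w (k + 1)| ≤ C * α (k + 1)) :
    Tendsto w atTop (𝓝 0) := by
  refine (tendsto_add_atTop_iff_nat 1).1 ?_
  refine tendsto_zero_of_summable_mul_sq (α := fun k => α (k + 1)) (fun k => hα _) (fun k => hw _)
    ?_ ((summable_nat_add_iff 1).2 hα_sq) ((summable_nat_add_iff 1).2 hsum) hinc
  rw [← not_summable_iff_tendsto_nat_atTop_of_nonneg fun k => (hα _).le] at hα_sum ⊢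
  rwa [summable_nat_add_iff 1]

/-! ### Weak convexity of the objective and properties of a single step -/

namespace IsModelMethod

variable {E Ξ Ω : Type*} [NormedAddCommGroup E] [InnerProductSpace ℝ E]
    [MeasurableSpace E] [MeasurableSpace Ξ] [MeasurableSpace Ω] {D : Measure Ξ} {P : Measure Ω}
    {U C : Set E} {f φ : E → ℝ} {M : E → E → Ξ → ℝ} {τ η L : ℝ} {Lφ : ℝ≥0}
    {α : ℕ → ℝ} {ξ : ℕ → Ω → Ξ} {x : ℕ → Ω → E}

/-- Use the model based at the convex combination `z` itself: its mean is exact at `z`, and it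
overestimates `f` in mean by at most `τ/2` times the squared distance at the endpoints. Since `(1 -
t)t² + t(1 - t)² = t(1 - t)`, these errors contribute exactly `τ` to the modulus. -/
theorem weaklyConvexOn_objective (H : IsModelMethod D P U C f φ M τ η L Lφ α ξ x)
    [IsProbabilityMeasure D] : WeaklyConvexOn (τ + η) C (fun y => f y + φ y) := by
  refine WeaklyConvexOn.of_segment_le H.convex fun a ha b hb t ht0 ht1 => ?_
  set z := (1 - t) • a + t • b with hz
  have hzC : z ∈ C := H.convex.one_sub_smul_add_smul_mem ha hb ht0 ht1
  have hzU := H.subset hzC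
  have ia := H.integrable_model z hzU a (H.subset ha)
  have ib := H.integrable_model z hzU b (H.subset hb)
  have iz := H.integrable_model z hzU z hzU
  have h1 : ∫ s, (M z z s + φ z) ∂D ≤ ∫ s, ((1 - t) * (M z a s + φ a) + t * (M z b s + φ b)
      + η / 2 * (t * (1 - t)) * ‖a - b‖ ^ 2) ∂D := by
    refine integral_mono_ae (by fun_prop) (by fun_prop) ?_
    filter_upwards [H.model_weaklyConvex z hzU] with s hs
    exact hs.segment_le ha hb ht0 ht1
  have h2 : ∀ c : ℝ, ∀ y ∈ U, ∫ s, (M z y s + c) ∂D = ∫ s, M z y s ∂D + c := fun c y hy => by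
    rw [integral_add (H.integrable_model z hzU y hy) (integrable_const _)]; simp
  rw [h2 _ _ hzU, integral_add (by fun_prop) (by fun_prop),
    integral_add (by fun_prop) (by fun_prop),
    integral_const_mul (1 - t), integral_const_mul t, h2 _ _ (H.subset ha),
    h2 _ _ (H.subset hb), H.model_self z hzU,
    integral_const] at h1
  simp only [probReal_univ, one_smul] at h1
  have h3 := H.model_le z hzU a (H.subset ha)
  have h4 := H.model_le z hzU b (H.subset hb)
  have e1 : ‖z - a‖ ^ 2 = t ^ 2 * ‖a - b‖ ^ 2 := by
    rw [hz, norm_sq_convex_comb_sub]; simp [norm_sub_rev b a]; ring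
  have e2 : ‖z - b‖ ^ 2 = (1 - t) ^ 2 * ‖a - b‖ ^ 2 := by
    rw [hz, norm_sq_convex_comb_sub]; simp; ring
  rw [e1] at h3
  rw [e2] at h4
  have h5 := mul_le_mul_of_nonneg_left h3 (by linarith : 0 ≤ 1 - t)
  have h6 := mul_le_mul_of_nonneg_left h4 ht0
  nlinarith

theorem succ_mem (H : IsModelMethod D P U C f φ M τ η L Lφ α ξ x) (k : ℕ) :
    ∀ᵐ ω ∂P, x (k + 1) ω ∈ C :=
  (H.step k).mono fun _ h => h.1

theorem mem_U (H : IsModelMethod D P U C f φ M τ η L Lφ α ξ x) (k : ℕ) :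
    ∀ᵐ ω ∂P, x k ω ∈ U := by
  cases k with
  | zero => exact Eventually.of_forall H.init_mem
  | succ k => exact (H.succ_mem k).mono fun _ h => H.subset h

theorem measurable_iterate (H : IsModelMethod D P U C f φ M τ η L Lφ α ξ x) (k : ℕ) :
    Measurable (x k) :=
  (H.adapted k).mono (sampleHistory_le H.measurable_sample k) le_rfl

theorem reg_sub_le (H : IsModelMethod D P U C f φ M τ η L Lφ α ξ x) {a b : E} (ha : a ∈ C)
    (hb : b ∈ C) : φ a - φ b ≤ Lφ * ‖a - b‖ := by
  have := H.lipschitz_reg.dist_le_mul a ha b hb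
  rw [Real.dist_eq, dist_eq_norm] at this
  exact (le_abs_self _).trans this

variable [FiniteDimensional ℝ E]

/-- The Lipschitz hypothesis has a null set depending on `b`. Adding `φ` and the quadratic to both
sides makes the model convex and the lower bound continuous on `C`, so a countable set of `b`
suffices. -/
theorem ae_forall_model_ge (H : IsModelMethod D P U C f φ M τ η L Lφ α ξ x) {a : E}
    (ha : a ∈ U) : ∀ᵐ s ∂D, ∀ b ∈ C, M a a s - L * ‖a - b‖ ≤ M a b s := by
  obtain ⟨Q, hQc, hQC, hQ⟩ := H.convex.exists_countable_test H.nonempty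
  have h1 : ∀ᵐ s ∂D, ∀ q ∈ Q, M a a s - M a q s ≤ L * ‖a - q‖ :=
    (ae_ball_iff hQc).2 fun q hq => H.model_lip a ha q (H.subset (hQC hq))
  filter_upwards [h1, H.model_weaklyConvex a ha] with s hs hw b hb
  have hφ := H.lipschitz_reg.continuousOn
  have := hQ (fun y => M a y s + φ y + η / 2 * ‖y‖ ^ 2)
    (fun y => M a a s - L * ‖a - y‖ + φ y + η / 2 * ‖y‖ ^ 2) hw (by fun_prop)
    (fun q hq => by linarith [hs q hq]) b hb
  linarith

variable [BorelSpace E] [IsProbabilityMeasure D] [IsProbabilityMeasure P]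

theorem ae_model_ge (H : IsModelMethod D P U C f φ M τ η L Lφ α ξ x) (k : ℕ) :
    ∀ᵐ ω ∂P, M (x k ω) (x k ω) (ξ k ω) - L * ‖x k ω - x (k + 1) ω‖
      ≤ M (x k ω) (x (k + 1) ω) (ξ k ω) := by
  have hm := measurable_extendZero H.isOpen.measurableSet H.measurable_model
  have hQ : MeasurableSet {q : E × E × Ξ | extendZero U M (q.1, q.1, q.2.2) - L * ‖q.1 - q.2.1‖
      ≤ extendZero U M q} :=
    measurableSet_le (by fun_prop) hm
  have := ae_mem_of_forall_ae H.measurable_sample H.indep H.law H.adapted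
    H.isOpen.measurableSet H.isClosed.measurableSet hQ (fun a ha => by
      filter_upwards [H.ae_forall_model_ge ha] with s hs b hb
      rw [extendZero_apply M ha ha, extendZero_apply M ha (H.subset hb)]
      exact hs b hb) k
  filter_upwards [this, H.mem_U k, H.succ_mem k] with ω h1 h2 h3
  have h4 := h1 h2 h3
  change _ ≤ _ at h4
  rwa [extendZero_apply M h2 h2, extendZero_apply M h2 (H.subset h3)] at h4

/-- Convexity is not itself stated as a measurable relation, but the inequality at one fixed
parameter is; countably many parameters tending to zero are enough for quadratic growth. -/
theorem ae_model_segment_le (H : IsModelMethod D P U C f φ M τ η L Lφ α ξ x) {p : E → E}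
    (hp : Measurable p) (hpC : ∀ z, p z ∈ C) (k : ℕ) :
    ∀ᵐ ω ∂P, ∀ m, M (x k ω) ((1 - segParam m) • x (k + 1) ω + segParam m • p (x k ω)) (ξ k ω)
        + φ ((1 - segParam m) • x (k + 1) ω + segParam m • p (x k ω))
      ≤ (1 - segParam m) * (M (x k ω) (x (k + 1) ω) (ξ k ω) + φ (x (k + 1) ω))
        + segParam m * (M (x k ω) (p (x k ω)) (ξ k ω) + φ (p (x k ω)))
        + η / 2 * (segParam m * (1 - segParam m)) * ‖x (k + 1) ω - p (x k ω)‖ ^ 2 := by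
  rw [ae_all_iff]
  intro m
  have hm := measurable_extendZero H.isOpen.measurableSet H.measurable_model
  have hφ := H.measurable_reg
  set t := segParam m with ht
  have ht0 : 0 ≤ t := (segParam_pos m).le
  have ht1 : t ≤ 1 := segParam_le_one m
  have hQ : MeasurableSet {q : E × E × Ξ |
      extendZero U M (q.1, (1 - t) • q.2.1 + t • p q.1, q.2.2) + φ ((1 - t) • q.2.1 + t • p q.1)
      ≤ (1 - t) * (extendZero U M q + φ q.2.1)
        + t * (extendZero U M (q.1, p q.1, q.2.2) + φ (p q.1))
        + η / 2 * (t * (1 - t)) * ‖q.2.1 - p q.1‖ ^ 2} :=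
    measurableSet_le (by fun_prop) (by fun_prop)
  have hseg : ∀ a, ∀ b ∈ C, (1 - t) • b + t • p a ∈ C := fun a b hb =>
    H.convex.one_sub_smul_add_smul_mem hb (hpC a) ht0 ht1
  have := ae_mem_of_forall_ae H.measurable_sample H.indep H.law H.adapted
    H.isOpen.measurableSet H.isClosed.measurableSet hQ (fun a ha => by
      filter_upwards [H.model_weaklyConvex a ha] with s hs b hb
      rw [extendZero_apply M ha (H.subset (hseg a b hb)), extendZero_apply M ha (H.subset hb),
        extendZero_apply M ha (H.subset (hpC a))]
      exact hs.segment_le hb (hpC a) ht0 ht1) k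
  filter_upwards [this, H.mem_U k, H.succ_mem k] with ω h1 h2 h3
  have h4 := h1 h2 h3
  change _ ≤ _ at h4
  rwa [extendZero_apply M h2 (H.subset (hseg _ _ h3)), extendZero_apply M h2 (H.subset h3),
    extendZero_apply M h2 (H.subset (hpC _))] at h4

/-- Quadratic growth of the regularized model at the new iterate. -/
theorem ae_quadratic_growth (H : IsModelMethod D P U C f φ M τ η L Lφ α ξ x) {p : E → E}
    (hp : Measurable p) (hpC : ∀ z, p z ∈ C) (k : ℕ) :
    ∀ᵐ ω ∂P, M (x k ω) (x (k + 1) ω) (ξ k ω) + φ (x (k + 1) ω)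
        + 1 / (2 * α k) * ‖x (k + 1) ω - x k ω‖ ^ 2
        + (1 / α k - η) / 2 * ‖x (k + 1) ω - p (x k ω)‖ ^ 2
      ≤ M (x k ω) (p (x k ω)) (ξ k ω) + φ (p (x k ω))
        + 1 / (2 * α k) * ‖p (x k ω) - x k ω‖ ^ 2 := by
  filter_upwards [H.ae_model_segment_le hp hpC k, H.step k] with ω h1 h2
  exact quadratic_growth_of_segment (G := fun y => M (x k ω) y (ξ k ω) + φ y) h1
    fun m => h2.2 _ (H.convex.one_sub_smul_add_smul_mem h2.1 (hpC _) (segParam_pos m).le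
      (segParam_le_one m))

/-- When `xᵏ ∈ C` it is itself a candidate in the step problem, and the Lipschitz bounds give
`r²/(2α) ≤ (L + Lφ) r` for the step length `r`. -/
theorem ae_norm_step_le (H : IsModelMethod D P U C f φ M τ η L Lφ α ξ x) (k : ℕ) :
    ∀ᵐ ω ∂P, x k ω ∈ C → ‖x (k + 1) ω - x k ω‖ ≤ 2 * (L + Lφ) * α k := by
  filter_upwards [H.ae_model_ge k, H.step k] with ω h1 h2 hx
  have h3 := h2.2 _ hx
  have h4 := H.reg_sub_le hx h2.1
  rw [norm_sub_rev] at h1 h4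
  set r := ‖x (k + 1) ω - x k ω‖
  have hα := H.step_pos k
  have h5 : 1 / (2 * α k) * r ^ 2 ≤ (L + Lφ) * r := by
    simp at h3
    simp
    linarith
  rcases (norm_nonneg _ : 0 ≤ r).eq_or_lt with h0 | h0
  · have h6 : r = 0 := h0.symm
    have := H.lip_pos
    rw [h6]; positivity
  · refine le_of_mul_le_mul_right ?_ h0
    have h6 := mul_le_mul_of_nonneg_left h5 (by positivity : 0 ≤ 2 * α k)
    have h7 : 2 * α k * (1 / (2 * α k) * r ^ 2) = r * r := by field_simp
    linarith

theorem memLp_two (H : IsModelMethod D P U C f φ M τ η L Lφ α ξ x) (k : ℕ) : MemLp (x k) 2 P := by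
  -- The initial history is trivial, so `x⁰` is constant.
  obtain ⟨a, ha⟩ : ∃ a, x 0 = fun _ => a := by
    have h := H.adapted 0
    have h0 : sampleHistory ξ 0 = ⊥ := iSup_of_empty _
    rw [h0] at h
    exact stronglyMeasurable_bot_iff.1 h.stronglyMeasurable
  have h0 : MemLp (x 0) 2 P := by rw [ha]; exact memLp_const a
  induction k with
  | zero => exact h0
  | succ k ih =>
    suffices hs : MemLp (fun ω => x (k + 1) ω - x k ω) 2 P by
      have := hs.add ih
      refine this.ae_eq (Eventually.of_forall fun ω => ?_)
      simp
    have hmeas : Measurable fun ω => x (k + 1) ω - x k ω :=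
      (H.measurable_iterate _).sub (H.measurable_iterate _)
    cases k with
    | succ k =>
      refine MemLp.of_bound hmeas.aestronglyMeasurable (2 * (L + Lφ) * α (k + 1)) ?_
      filter_upwards [H.ae_norm_step_le (k + 1), H.succ_mem k] with ω h1 h2 using h1 h2
    | zero =>
      -- In the first step `x⁰` may lie outside `C`, so the comparison point is a fixed `c ∈ C`.
      -- This gives `r² ≤ 2α₀A + 2α₀(L + Lφ)r` with `A` integrable, and the linear term in `r` is
      -- absorbed by completing the square.
      obtain ⟨c, hc⟩ := H.nonempty
      have hfin : Nonempty Ω := by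
        by_contra hcon
        rw [not_nonempty_iff] at hcon
        have := measure_univ (μ := P)
        simp [Set.univ_eq_empty_iff.2 hcon] at this
      have haU : a ∈ U := by
        have := H.init_mem hfin.some
        rwa [ha] at this
      have hα := H.step_pos 0
      have hL := H.lip_pos
      have hint : ∀ y ∈ U, Integrable (fun ω => M a y (ξ 0 ω)) P := fun y hy => by
        have := H.integrable_model a haU y hy
        rw [← H.law 0] at this
        exact this.comp_measurable (H.measurable_sample 0)
      have i1 := hint c (H.subset hc)
      have i2 := hint a haU
      rw [memLp_two_iff_integrable_sq_norm hmeas.aestronglyMeasurable]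
      refine Integrable.mono' (g := fun ω => 4 * α 0 * (M a c (ξ 0 ω) - M a a (ξ 0 ω)
        + 1 / (2 * α 0) * ‖c - a‖ ^ 2 + Lφ * ‖c - a‖) + 4 * α 0 ^ 2 * (L + Lφ) ^ 2)
        (((((i1.sub i2).add (integrable_const _)).add (integrable_const _)).const_mul _).add
          (integrable_const _)) (hmeas.norm.pow_const 2).aestronglyMeasurable ?_
      filter_upwards [H.ae_model_ge 0, H.step 0] with ω h1 h2
      have h3 := h2.2 _ hc
      have h4 := H.reg_sub_le hc h2.1
      rw [Real.norm_of_nonneg (by positivity)]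
      simp only [ha, zero_add] at h1 h2 h3 h4 ⊢
      rw [norm_sub_rev] at h1
      have h5 : ‖c - x 1 ω‖ ≤ ‖c - a‖ + ‖x 1 ω - a‖ := by
        rw [norm_sub_rev (x 1 ω) a]; exact norm_sub_le_norm_sub_add_norm_sub _ _ _
      set r := ‖x 1 ω - a‖
      have h6 := mul_le_mul_of_nonneg_left h5 Lφ.2
      have h7 : 1 / (2 * α 0) * r ^ 2 ≤ (M a c (ξ 0 ω) - M a a (ξ 0 ω)
        + 1 / (2 * α 0) * ‖c - a‖ ^ 2 + Lφ * ‖c - a‖) + (L + Lφ) * r := by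
        simp only [NNReal.val_eq_coe] at h6
        linarith
      set A := M a c (ξ 0 ω) - M a a (ξ 0 ω) + 1 / (2 * α 0) * ‖c - a‖ ^ 2 + Lφ * ‖c - a‖
      have h8 := mul_le_mul_of_nonneg_left h7 (by positivity : 0 ≤ 2 * α 0)
      have h9 : 2 * α 0 * (1 / (2 * α 0) * r ^ 2) = r ^ 2 := by field_simp
      nlinarith [sq_nonneg (r - 2 * α 0 * (L + Lφ))]

end IsModelMethod

/-! ### Decrease of the Moreau envelope along the iterates -/

namespace IsModelMethod

variable {E Ξ Ω : Type*} [NormedAddCommGroup E] [InnerProductSpace ℝ E]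
    [FiniteDimensional ℝ E] [MeasurableSpace E] [BorelSpace E] [MeasurableSpace Ξ]
    [MeasurableSpace Ω] {D : Measure Ξ} {P : Measure Ω}
    [IsProbabilityMeasure D] [IsProbabilityMeasure P]
    {U C : Set E} {f φ : E → ℝ} {M : E → E → Ξ → ℝ} {τ η L : ℝ} {Lφ : ℝ≥0}
    {α : ℕ → ℝ} {ξ : ℕ → Ω → Ξ} {x : ℕ → Ω → E} {θ : ℝ} {p : E → E}

theorem memLp_two_prox (H : IsModelMethod D P U C f φ M τ η L Lφ α ξ x)
    (hp : IsProxMap θ C (fun y => f y + φ y) p) (hθ : 0 < θ) (hρ : 0 < 1 / θ - (τ + η)) (k : ℕ) :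
    MemLp (fun ω => p (x k ω)) 2 P := by
  have hpc := hp.continuous H.weaklyConvexOn_objective hθ hρ
  have h1 : MemLp (fun ω => p (x k ω) - p 0) 2 P := by
    refine (H.memLp_two k).of_le_mul (c := 1 / (θ * (1 / θ - (τ + η))))
      ((hpc.measurable.comp (H.measurable_iterate k)).sub_const _).aestronglyMeasurable
      (Eventually.of_forall fun ω => ?_)
    simpa using hp.norm_sub_le H.weaklyConvexOn_objective hθ hρ (x k ω) 0
  refine (h1.add (memLp_const (p 0))).ae_eq (Eventually.of_forall fun ω => ?_)
  simp

/-- The expected squared distance from the new iterate to the proximal point contracts. -/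
theorem integral_norm_sq_prox_sub_succ_le (H : IsModelMethod D P U C f φ M τ η L Lφ α ξ x)
    (hp : IsProxMap θ C (fun y => f y + φ y) p) (hθ : 0 < θ) (hρ : 0 < 1 / θ - (τ + η)) (k : ℕ)
    (hxC : ∀ᵐ ω ∂P, x k ω ∈ C) :
    (1 - α k * η) * ∫ ω, ‖x (k + 1) ω - p (x k ω)‖ ^ 2 ∂P
      ≤ (1 - α k * η - 2 * α k * (1 / θ - (τ + η))) * ∫ ω, ‖x k ω - p (x k ω)‖ ^ 2 ∂P
        + α k ^ 2 * (L + Lφ) ^ 2 := by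
  have hwc := H.weaklyConvexOn_objective
  have hpc := hp.continuous hwc hθ hρ
  have hpm := hpc.measurable
  have hpC : ∀ z, p z ∈ C := fun z => (hp z).1
  have hφm := H.measurable_reg
  have hm := measurable_extendZero H.isOpen.measurableSet H.measurable_model
  have hα := H.step_pos k
  set Λ := L + Lφ with hΛ
  set κ := 1 / θ - (τ + η) with hκ
  -- The model change between `a` and `p a`, shifted by `Λ‖a - p a‖` to be nonnegative almost
  -- surely; the shift is subtracted again after integration.
  let T : E × Ξ → ℝ := fun q => extendZero U M (q.1, p q.1, q.2) - extendZero U M (q.1, q.1, q.2)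
    + (φ (p q.1) - φ q.1) + Λ * ‖q.1 - p q.1‖
  have hT : Measurable T := by fun_prop
  have hTe : ∀ a ∈ C, ∀ s, T (a, s)
      = M a (p a) s - M a a s + (φ (p a) - φ a) + Λ * ‖a - p a‖ := by
    intro a ha s
    simp only [T]
    rw [extendZero_apply M (H.subset ha) (H.subset (hpC a)),
      extendZero_apply M (H.subset ha) (H.subset ha)]
  -- Growth at `p a` gives `ψ(p a) - ψ(a) ≤ -(1/θ - (τ + η)/2)‖a - p a‖²`; the model error adds
  -- `τ/2` and the shift adds the last term.
  let B : E → ℝ := fun a => -(1 / θ - (τ + η) / 2 - τ / 2) * ‖a - p a‖ ^ 2 + Λ * ‖a - p a‖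
  have hB : Measurable B := by fun_prop
  have isq := integrable_norm_sq_sub (H.memLp_two k) (H.memLp_two_prox hp hθ hρ k)
  have inr := integrable_norm_sub (H.memLp_two k) (H.memLp_two_prox hp hθ hρ k)
  have isq' := integrable_norm_sq_sub (H.memLp_two (k + 1)) (H.memLp_two_prox hp hθ hρ k)
  have hBi : Integrable (fun ω => B (x k ω)) P := (isq.const_mul _).add (inr.const_mul _)
  have hTint : ∀ a ∈ C, Integrable (fun s => T (a, s)) D := by
    intro a ha
    simp only [hTe a ha]
    exact (((H.integrable_model a (H.subset ha) _ (H.subset (hpC a))).sub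
      (H.integrable_model a (H.subset ha) _ (H.subset ha))).add (integrable_const _)).add
      (integrable_const _)
  obtain ⟨hTi, hTB⟩ := integrable_and_integral_le_of_sample (P := P) (D := D) (T := T) (B := B)
    H.measurable_sample H.indep H.law H.adapted H.isClosed.measurableSet hT hB
    (fun a ha => by
      filter_upwards [H.model_lip a (H.subset ha) _ (H.subset (hpC a))] with s hs
      rw [hTe a ha, hΛ]
      linarith [H.reg_sub_le ha (hpC a)])
    hTint
    (fun a ha => by
      have i1 := H.integrable_model a (H.subset ha) _ (H.subset (hpC a))
      have i2 := H.integrable_model a (H.subset ha) _ (H.subset ha)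
      have e : ∫ s, T (a, s) ∂D = ∫ s, M a (p a) s ∂D - ∫ s, M a a s ∂D + (φ (p a) - φ a)
          + Λ * ‖a - p a‖ := by
        simp only [hTe a ha]
        rw [integral_add (f := fun s => M a (p a) s - M a a s + (φ (p a) - φ a))
            ((i1.sub i2).add (integrable_const _)) (integrable_const _),
          integral_add (f := fun s => M a (p a) s - M a a s) (i1.sub i2) (integrable_const _),
          integral_sub i1 i2]
        simp
      have h1 := H.model_le a (H.subset ha) _ (H.subset (hpC a))
      have h2 := hp.quadratic_growth hwc a ha
      have h7 : 1 / (2 * θ) = 1 / θ / 2 := by rw [mul_comm, ← div_div]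
      rw [h7, norm_sub_rev (p a) a] at h2
      simp only [sub_self, norm_zero] at h2
      rw [e, H.model_self a (H.subset ha)]
      simp only [B]
      linarith) k hxC hBi
  have hae : ∀ᵐ ω ∂P, (1 - α k * η) * ‖x (k + 1) ω - p (x k ω)‖ ^ 2
      ≤ 2 * α k * T (x k ω, ξ k ω) - 2 * α k * Λ * ‖x k ω - p (x k ω)‖ + α k ^ 2 * Λ ^ 2
        + ‖x k ω - p (x k ω)‖ ^ 2 := by
    filter_upwards [hxC, H.succ_mem k, H.ae_quadratic_growth hpm hpC k, H.ae_model_ge k]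
      with ω h1 h2 h3 h4
    have h5 := H.reg_sub_le h1 h2
    rw [norm_sub_rev (x (k + 1) ω) (x k ω), norm_sub_rev (p (x k ω)) (x k ω)] at h3
    rw [hTe _ h1]
    set r := ‖x k ω - x (k + 1) ω‖
    set d := ‖x k ω - p (x k ω)‖
    set d' := ‖x (k + 1) ω - p (x k ω)‖
    have h6 : 1 / (2 * α k) * r ^ 2 + (1 / α k - η) / 2 * d' ^ 2 ≤
        (M (x k ω) (p (x k ω)) (ξ k ω) - M (x k ω) (x k ω) (ξ k ω)
          + (φ (p (x k ω)) - φ (x k ω))) + Λ * r + 1 / (2 * α k) * d ^ 2 := by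
      rw [hΛ]; linarith
    have h7 := mul_le_mul_of_nonneg_left h6 (by positivity : 0 ≤ 2 * α k)
    have e1 : 2 * α k * (1 / (2 * α k) * r ^ 2 + (1 / α k - η) / 2 * d' ^ 2)
        = r ^ 2 + (1 - α k * η) * d' ^ 2 := by field_simp
    have e2 : 2 * α k * (1 / (2 * α k) * d ^ 2) = d ^ 2 := by field_simp
    rw [e1, mul_add, e2] at h7
    -- The step length is eliminated through `2αΛr - r² ≤ α²Λ²`.
    nlinarith [sq_nonneg (r - α k * Λ)]
  have hI := integral_mono_ae (isq'.const_mul _)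
    ((((hTi.const_mul (2 * α k)).sub (inr.const_mul (2 * α k * Λ))).add
      (integrable_const (α k ^ 2 * Λ ^ 2))).add isq) hae
  have e3 : ∫ ω, B (x k ω) ∂P = -(1 / θ - (τ + η) / 2 - τ / 2) * ∫ ω, ‖x k ω - p (x k ω)‖ ^ 2 ∂P
      + Λ * ∫ ω, ‖x k ω - p (x k ω)‖ ∂P := by
    simp only [B]
    rw [integral_add (isq.const_mul _) (inr.const_mul _), integral_const_mul, integral_const_mul]
  rw [integral_const_mul] at hI
  have e4 : ∫ ω, (2 * α k * T (x k ω, ξ k ω) - 2 * α k * Λ * ‖x k ω - p (x k ω)‖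
      + α k ^ 2 * Λ ^ 2 + ‖x k ω - p (x k ω)‖ ^ 2) ∂P
      = 2 * α k * ∫ ω, T (x k ω, ξ k ω) ∂P - 2 * α k * Λ * ∫ ω, ‖x k ω - p (x k ω)‖ ∂P
        + α k ^ 2 * Λ ^ 2 + ∫ ω, ‖x k ω - p (x k ω)‖ ^ 2 ∂P := by
    have j1 := hTi.const_mul (2 * α k)
    have j2 := inr.const_mul (2 * α k * Λ)
    rw [integral_add (f := fun ω => 2 * α k * T (x k ω, ξ k ω)
        - 2 * α k * Λ * ‖x k ω - p (x k ω)‖ + α k ^ 2 * Λ ^ 2)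
        ((j1.sub j2).add (integrable_const _)) isq,
      integral_add (f := fun ω => 2 * α k * T (x k ω, ξ k ω)
        - 2 * α k * Λ * ‖x k ω - p (x k ω)‖) (j1.sub j2) (integrable_const _),
      integral_sub j1 j2, integral_const_mul, integral_const_mul]
    simp
  have hI' := hI.trans_eq e4
  rw [e3] at hTB
  have h8 := mul_le_mul_of_nonneg_left hTB (by positivity : 0 ≤ 2 * α k)
  refine hI'.trans ?_
  have e5 : (1 - α k * η - 2 * α k * κ) = 1 + 2 * α k * (-(1 / θ - (τ + η) / 2 - τ / 2)) := by
    rw [hκ]; ring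
  rw [e5]
  linarith

theorem integrable_proxEnv (H : IsModelMethod D P U C f φ M τ η L Lφ α ξ x)
    (hp : IsProxMap θ C (fun y => f y + φ y) p) (hθ : 0 < θ) (hρ : 0 < 1 / θ - (τ + η))
    {b : ℝ} (hb : ∀ y ∈ C, b ≤ f y + φ y) (k : ℕ) :
    Integrable (fun ω => proxEnv θ (fun y => f y + φ y) p (x k ω)) P := by
  obtain ⟨c, hc⟩ := H.nonempty
  have hcont : Continuous (proxEnv θ (fun y => f y + φ y) p) :=
    continuous_iff_continuousAt.2 fun z =>
      (hp.hasGradientAt H.weaklyConvexOn_objective hθ hρ z).hasFDerivAt.continuousAt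
  have hi := integrable_norm_sq_sub (memLp_const c) (H.memLp_two k)
  refine Integrable.mono' (g := fun ω => |b| + (|f c + φ c| + 1 / (2 * θ) * ‖c - x k ω‖ ^ 2))
    ((integrable_const _).add ((integrable_const _).add (hi.const_mul _)))
    (hcont.measurable.comp (H.measurable_iterate k)).aestronglyMeasurable
    (Eventually.of_forall fun ω => ?_)
  have h1 := (hp (x k ω)).2 c hc
  have h2 := hb _ (hp (x k ω)).1
  have h3 : 0 ≤ 1 / (2 * θ) * ‖p (x k ω) - x k ω‖ ^ 2 := by positivity
  have h4 : 0 ≤ 1 / (2 * θ) * ‖c - x k ω‖ ^ 2 := by positivity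
  rw [Real.norm_eq_abs, abs_le, proxEnv]
  constructor
  · linarith [neg_abs_le b, abs_nonneg (f c + φ c)]
  · linarith [le_abs_self (f c + φ c), abs_nonneg b]

/-- The expected envelope is a Lyapunov function, bounded below by `b`: its decrease dominates `α
𝔼‖x - p x‖²` up to `O(α²)`. -/
theorem summable_integral_norm_sq (H : IsModelMethod D P U C f φ M τ η L Lφ α ξ x)
    (hp : IsProxMap θ C (fun y => f y + φ y) p) (hθ : 0 < θ) (hρ : 0 < 1 / θ - (τ + η))
    {b : ℝ} (hb : ∀ y ∈ C, b ≤ f y + φ y) (hα_sq : Summable (fun k => α k ^ 2)) :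
    Summable fun k => α k * ∫ ω, ‖x k ω - p (x k ω)‖ ^ 2 ∂P := by
  have hα0 : Tendsto (fun k => α k * η) atTop (𝓝 0) := by
    have h1 : Tendsto (fun k => √(α k ^ 2)) atTop (𝓝 (√0)) :=
      (Real.continuous_sqrt.tendsto 0).comp hα_sq.tendsto_atTop_zero
    have h2 : ∀ k, √(α k ^ 2) = α k := fun k => Real.sqrt_sq (H.step_pos k).le
    simpa [h2] using h1.mul_const η
  have hev : ∀ᶠ k in atTop, |α k * η| < 1 / 2 := by
    have := hα0.abs
    rw [abs_zero] at this
    exact this.eventually_lt_const (by norm_num)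
  obtain ⟨K, hK⟩ := eventually_atTop.1 hev
  set κ := 1 / θ - (τ + η) with hκ
  set Λ := L + Lφ with hΛ
  set d : ℕ → ℝ := fun k => ∫ ω, ‖x k ω - p (x k ω)‖ ^ 2 ∂P with hd
  have hd0 : ∀ k, 0 ≤ d k := fun k => integral_nonneg fun ω => by positivity
  set e : ℕ → ℝ := fun k => ∫ ω, proxEnv θ (fun y => f y + φ y) p (x k ω) ∂P with he
  have heb : ∀ k, b ≤ e k := by
    intro k
    have : ∫ _, b ∂P ≤ e k := integral_mono (integrable_const _)
      (H.integrable_proxEnv hp hθ hρ hb k) fun ω => by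
        have h3 : 0 ≤ 1 / (2 * θ) * ‖p (x k ω) - x k ω‖ ^ 2 := by positivity
        simp only [proxEnv]
        linarith [hb _ (hp (x k ω)).1]
    simpa using this
  -- The old proximal point `p(xᵏ)` is a candidate in the envelope at `xᵏ⁺¹`, and the values of `ψ`
  -- cancel.
  have hdesc : ∀ k, 2 * θ * (e (k + 1) - e k)
      ≤ ∫ ω, ‖x (k + 1) ω - p (x k ω)‖ ^ 2 ∂P - d k := by
    intro k
    have i1 := integrable_norm_sq_sub (H.memLp_two (k + 1)) (H.memLp_two_prox hp hθ hρ k)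
    have i2 := integrable_norm_sq_sub (H.memLp_two k) (H.memLp_two_prox hp hθ hρ k)
    have i3 := H.integrable_proxEnv hp hθ hρ hb k
    have i4 := H.integrable_proxEnv hp hθ hρ hb (k + 1)
    have := integral_mono ((i4.sub i3).const_mul (2 * θ)) (i1.sub i2) fun ω => by
      have h1 := (hp (x (k + 1) ω)).2 _ (hp (x k ω)).1
      simp only [Pi.sub_apply, proxEnv]
      rw [norm_sub_rev (x (k + 1) ω), norm_sub_rev (x k ω)]
      have h2 := mul_le_mul_of_nonneg_left h1 (by positivity : 0 ≤ 2 * θ)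
      have e1 : ∀ r : ℝ, 2 * θ * (1 / (2 * θ) * r) = r := fun r => by field_simp
      simp only [mul_add, e1, mul_sub] at h2 ⊢
      linarith
    rw [integral_const_mul, integral_sub' i4 i3, integral_sub' i1 i2] at this
    exact this
  -- Beyond `K` the factor `q = 1 - αη` lies in `[1/2, 3/2]`; dividing by it produces the constants
  -- `4/3` and `2` below. The extra shift by one ensures that the current iterate is in `C`.
  have hκ4 : Summable fun k => 2 / (3 * θ) * κ * (α (k + (K + 1)) * d (k + (K + 1))) := by
    refine summable_of_descent (e := fun k => e (k + (K + 1))) (b := b)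
      (c := fun k => Λ ^ 2 / θ * α (k + (K + 1)) ^ 2) (fun k => heb _) (fun k => ?_)
      (fun k => by positivity) (((summable_nat_add_iff (K + 1)).2 hα_sq).mul_left _) (fun k => ?_)
    · have := hd0 (k + (K + 1))
      have := H.step_pos (k + (K + 1))
      positivity
    · have h1 := hK (k + (K + 1)) (by omega)
      have h2 := hdesc (k + (K + 1))
      have h3 := H.integral_norm_sq_prox_sub_succ_le hp hθ hρ (k + (K + 1)) (H.succ_mem (k + K))
      have e1 : k + 1 + (K + 1) = k + (K + 1) + 1 := by omega
      rw [e1]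
      set j := k + (K + 1)
      rw [abs_lt] at h1
      set q := 1 - α j * η
      have hq1 : 1 / 2 ≤ q := by simp only [q]; linarith
      have hq2 : q ≤ 3 / 2 := by simp only [q]; linarith
      have hα := H.step_pos j
      have h4 : q * (2 * θ * (e (j + 1) - e j)) ≤ -(2 * α j * κ * d j) + α j ^ 2 * Λ ^ 2 := by
        have := mul_le_mul_of_nonneg_left h2 (by linarith : 0 ≤ q)
        linarith
      have h5 : 2 * θ * (e (j + 1) - e j)
          ≤ -(4 / 3 * (α j * κ * d j)) + 2 * (α j ^ 2 * Λ ^ 2) := by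
        have hA : 0 ≤ α j * κ * d j := by have := hd0 j; positivity
        have hB : 0 ≤ α j ^ 2 * Λ ^ 2 := by positivity
        refine le_of_mul_le_mul_left (h4.trans ?_) (by linarith : 0 < q)
        nlinarith
      have h6 := mul_le_mul_of_nonneg_left h5 (by positivity : 0 ≤ 1 / (2 * θ))
      have e2 : 1 / (2 * θ) * (2 * θ * (e (j + 1) - e j)) = e (j + 1) - e j := by field_simp
      have e3 : 1 / (2 * θ) * (-(4 / 3 * (α j * κ * d j)) + 2 * (α j ^ 2 * Λ ^ 2))
          = -(2 / (3 * θ) * κ * (α j * d j)) + Λ ^ 2 / θ * α j ^ 2 := by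
        field_simp; ring
      rw [e2, e3] at h6
      linarith
  have hne : 2 / (3 * θ) * κ ≠ 0 := by positivity
  exact (summable_nat_add_iff (K + 1)).1 ((summable_mul_left_iff hne).1 hκ4)

/-- The distance of the iterates to their proximal points tends to zero in mean and almost
surely. -/
theorem tendsto_norm_sub_prox (H : IsModelMethod D P U C f φ M τ η L Lφ α ξ x)
    (hp : IsProxMap θ C (fun y => f y + φ y) p) (hθ : 0 < θ) (hρ : 0 < 1 / θ - (τ + η))
    {b : ℝ} (hb : ∀ y ∈ C, b ≤ f y + φ y)
    (hα_sum : Tendsto (fun K => ∑ k ∈ Finset.range K, α k) atTop atTop)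
    (hα_sq : Summable (fun k => α k ^ 2)) :
    Tendsto (fun k => ∫ ω, ‖x k ω - p (x k ω)‖ ∂P) atTop (𝓝 0) ∧
      ∀ᵐ ω ∂P, Tendsto (fun k => ‖x k ω - p (x k ω)‖) atTop (𝓝 0) := by
  have hsum := H.summable_integral_norm_sq hp hθ hρ hb hα_sq
  have i1 := fun k => integrable_norm_sub (H.memLp_two k) (H.memLp_two_prox hp hθ hρ k)
  have i2 := fun k => integrable_norm_sq_sub (H.memLp_two k) (H.memLp_two_prox hp hθ hρ k)
  set K := 1 / (θ * (1 / θ - (τ + η)))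
  have hK : 0 ≤ K := by positivity
  -- The map `z ↦ z - p z` is `(1 + K)`-Lipschitz, so the step bound controls the increments.
  have hinc : ∀ᵐ ω ∂P, ∀ k, |‖x (k + 2) ω - p (x (k + 2) ω)‖ - ‖x (k + 1) ω - p (x (k + 1) ω)‖|
      ≤ ((1 + K) * (2 * (L + Lφ))) * α (k + 1) := by
    rw [ae_all_iff]
    intro k
    filter_upwards [H.ae_norm_step_le (k + 1), H.succ_mem k] with ω h1 h2
    have h3 := h1 h2
    have h4 := hp.norm_sub_le H.weaklyConvexOn_objective hθ hρ (x (k + 2) ω) (x (k + 1) ω)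
    refine (abs_norm_sub_norm_le _ _).trans ?_
    have e : x (k + 2) ω - p (x (k + 2) ω) - (x (k + 1) ω - p (x (k + 1) ω))
      = (x (k + 2) ω - x (k + 1) ω) - (p (x (k + 2) ω) - p (x (k + 1) ω)) := by abel
    rw [e]
    refine (norm_sub_le _ _).trans ?_
    calc _ ≤ ‖x (k + 2) ω - x (k + 1) ω‖ + K * ‖x (k + 2) ω - x (k + 1) ω‖ := by gcongr
      _ = (1 + K) * ‖x (k + 2) ω - x (k + 1) ω‖ := by ring
      _ ≤ (1 + K) * (2 * (L + Lφ) * α (k + 1)) := by gcongr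
      _ = _ := by ring
  constructor
  -- For the means, Jensen's inequality replaces the second moment by the square of the first.
  · refine tendsto_zero_of_summable_mul_sq_succ (C := (1 + K) * (2 * (L + Lφ))) H.step_pos
      (fun k => integral_nonneg fun ω => norm_nonneg _) hα_sum hα_sq ?_ fun k => ?_
    · refine Summable.of_nonneg_of_le (fun k => ?_) (fun k => ?_) hsum
      · have := H.step_pos k; positivity
      · exact mul_le_mul_of_nonneg_left (sq_integral_le_integral_sq (i1 k) (i2 k))
          (H.step_pos k).le
    · rw [← integral_sub (i1 _) (i1 _)]
      have h := norm_integral_le_of_norm_le_const (μ := P)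
        (f := fun ω => ‖x (k + 2) ω - p (x (k + 2) ω)‖ - ‖x (k + 1) ω - p (x (k + 1) ω)‖)
        (hinc.mono fun ω hω => hω k)
      simpa using h
  -- For single paths, Tonelli turns the summable expectations into almost sure summability.
  · have hs := ae_summable_of_summable_integral (P := P)
      (g := fun k ω => α k * ‖x k ω - p (x k ω)‖ ^ 2) (fun k => (i2 k).const_mul _)
      (fun k ω => by have := H.step_pos k; positivity)
      (by simpa only [integral_const_mul] using hsum)
    filter_upwards [hs, hinc] with ω h1 h2
    exact tendsto_zero_of_summable_mul_sq_succ H.step_pos (fun k => norm_nonneg _) hα_sum hα_sq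
      h1 h2

end IsModelMethod

/-! ### Transfer to extended-real-valued functions and conclusion -/

theorem IsProxMap.congr {E : Type*} [NormedAddCommGroup E] [InnerProductSpace ℝ E] {θ : ℝ}
    {C : Set E} {ψ ψ' : E → ℝ} {p : E → E} (hp : IsProxMap θ C ψ p) (h : Set.EqOn ψ ψ' C) :
    IsProxMap θ C ψ' p := fun z =>
  ⟨(hp z).1, fun y hy => by rw [← h hy, ← h (hp z).1]; exact (hp z).2 y hy⟩

theorem corollary3p10 {n : ℕ}
    {Ξ : Type*} [MeasurableSpace Ξ] (D : Measure Ξ) [IsProbabilityMeasure D]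
    {Ω : Type*} [MeasurableSpace Ω] (P : Measure Ω) [IsProbabilityMeasure P]
    -- the problem data: samples `F (x, s)` of `f`, the regularizer `φ`, the open convex set `U`
    (F : EuclideanSpace ℝ (Fin n) → Ξ → ℝ) (φ : EuclideanSpace ℝ (Fin n) → EReal)
    (U : Set (EuclideanSpace ℝ (Fin n))) (hUo : IsOpen U) (hUc : Convex ℝ U)
    (hφU : effDom φ ⊆ U)
    (hF : ∀ x ∈ U, Integrable (F x) D)
    (hf_wc : ∃ ρ : ℝ, WeaklyConvexOn ρ U (fun x => ∫ s, F x s ∂D))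
    (hφ_wc : ∃ ρ : ℝ, WeaklyConvex ρ φ)
    (hφ_proper : IsProperFun φ) (hφ_lsc : LowerSemicontinuous φ)
    (hψ_lb : ∃ b : ℝ, ∀ x ∈ effDom φ, (b : EReal) ≤ compositeObjective D F φ x)
    -- the stochastic model functions `M x y s = f_x(y, s)`
    (M : EuclideanSpace ℝ (Fin n) → EuclideanSpace ℝ (Fin n) → Ξ → ℝ)
    (hM_meas : Measurable (fun p : U × U × Ξ => M p.1 p.2.1 p.2.2))
    (τ η L : ℝ) (Lφ : ℝ≥0)
    -- one-sided accuracy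
    (hM_int : ∀ x ∈ U, ∀ y ∈ U, Integrable (M x y) D)
    (hM_acc : ∀ x ∈ U, ∫ s, M x x s ∂D = ∫ s, F x s ∂D)
    (hM_one : ∀ x ∈ U, ∀ y ∈ U,
      ∫ s, (M x y s - ∫ s', F y s' ∂D) ∂D ≤ τ / 2 * ‖x - y‖ ^ 2)
    -- weak convexity of the model plus the regularizer
    (hM_wc : ∀ x ∈ U, ∀ᵐ s ∂D, WeaklyConvex η (fun y => (M x y s : EReal) + φ y))
    -- one-sided Lipschitz property of the model
    (hL : 0 < L)
    (hM_lip : ∀ x ∈ U, ∀ y ∈ U, ∀ᵐ s ∂D, M x x s - M x y s ≤ L * ‖x - y‖)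
    -- Lipschitz continuity of the regularizer on its domain
    (hφ_lip : LipschitzOnWith Lφ (fun x => (φ x).toReal) (effDom φ))
    -- step sizes
    (α : ℕ → ℝ) (hα_pos : ∀ k, 0 < α k)
    (hα_sum : Tendsto (fun K => ∑ k ∈ Finset.range K, α k) atTop atTop)
    (hα_sq : Summable (fun k => α k ^ 2))
    -- independent samples with distribution `D`
    (ξ : ℕ → Ω → Ξ) (hξ_meas : ∀ k, Measurable (ξ k)) (hξ_indep : iIndepFun ξ P)
    (hξ_law : ∀ k, P.map (ξ k) = D)
    -- the iterates: adapted, started in `U`, each one a minimizer of the regularized model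
    (x : ℕ → Ω → EuclideanSpace ℝ (Fin n))
    (hx_adapted : ∀ k, Measurable[sampleHistory ξ k] (x k))
    (hx_init : ∀ ω, x 0 ω ∈ U)
    (hx_step : ∀ k, ∀ᵐ ω ∂P,
      IsMinOn (proxObjective (α k) (fun y => (M (x k ω) y (ξ k ω) : EReal) + φ y) (x k ω))
        Set.univ (x (k + 1) ω))
    -- the parameter of the Moreau envelope
    (θ : ℝ) (hθ_pos : 0 < θ) (hθ : θ * (τ + η) < 1) :
    -- the envelope is well defined (a finite, attained minimum) and differentiable
    (∀ z, ∃ y, IsMinOn (proxObjective θ (compositeObjective D F φ) z) Set.univ y ∧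
      proxObjective θ (compositeObjective D F φ) z y
        = (moreauEnv θ (compositeObjective D F φ) z : EReal)) ∧
    Differentiable ℝ (moreauEnv θ (compositeObjective D F φ)) ∧
    -- convergence in expectation
    (∀ k, Integrable
      (fun ω => ‖gradient (moreauEnv θ (compositeObjective D F φ)) (x k ω)‖) P) ∧
    Tendsto
      (fun k => ∫ ω, ‖gradient (moreauEnv θ (compositeObjective D F φ)) (x k ω)‖ ∂P)
      atTop (𝓝 0) ∧
    -- almost sure convergence
    ∀ᵐ ω ∂P, Tendsto
      (fun k => ‖gradient (moreauEnv θ (compositeObjective D F φ)) (x k ω)‖)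
      atTop (𝓝 0) := by
  obtain ⟨hbot, hne⟩ := hφ_proper
  set C := effDom φ with hC
  set f : EuclideanSpace ℝ (Fin n) → ℝ := fun y => ∫ s, F y s ∂D with hf
  -- Off `C` this is the junk value 0. That is harmless: apart from measurability, the real-valued
  -- formulation constrains the regularizer only on `C`.
  set φr : EuclideanSpace ℝ (Fin n) → ℝ := fun y => (φ y).toReal with hφr
  have H : IsModelMethod D P U C f φr M τ η L Lφ α ξ x :=
    { isOpen := hUo
      subset := hφU
      isClosed := isClosed_effDom hbot hφ_lsc hφ_lip
      convex := by
        obtain ⟨ρ, -, hρ⟩ := hφ_wc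
        exact hρ.1
      nonempty := hne
      measurable_reg := hφ_lsc.measurable.ereal_toReal
      lipschitz_reg := hφ_lip
      measurable_model := hM_meas
      integrable_model := hM_int
      model_self := hM_acc
      model_le := fun a ha y hy => by
        have := hM_one a ha y hy
        rw [integral_sub (hM_int a ha y hy) (integrable_const _)] at this
        simp only [integral_const, probReal_univ, one_smul] at this
        linarith
      model_weaklyConvex := fun a ha => by
        filter_upwards [hM_wc a ha] with s hs
        have h2 := hs.2
        rw [effDom_coe_add] at h2
        refine ConvexOn.congr h2 fun y hy => ?_
        simp only [toReal_coe_add hbot (fun y => M a y s) hy, hφr]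
      lip_pos := hL
      model_lip := hM_lip
      step_pos := hα_pos
      measurable_sample := hξ_meas
      indep := hξ_indep
      law := hξ_law
      adapted := hx_adapted
      init_mem := hx_init
      step := fun k => by
        filter_upwards [hx_step k] with ω hω
        rw [isMinOn_proxObjective_iff (coe_add_ne_bot hbot _)
          (by rw [effDom_coe_add]; exact hne), effDom_coe_add] at hω
        refine ⟨hω.1, fun y hy => ?_⟩
        have := hω.2 y hy
        rwa [toReal_coe_add hbot (fun y => M (x k ω) y (ξ k ω)) hω.1,
          toReal_coe_add hbot (fun y => M (x k ω) y (ξ k ω)) hy] at this }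
  have hdom : effDom (compositeObjective D F φ) = C := effDom_coe_add f
  have hψbot : ∀ y, compositeObjective D F φ y ≠ ⊥ := coe_add_ne_bot hbot f
  have hψr : Set.EqOn (fun y => f y + φr y) (fun y => (compositeObjective D F φ y).toReal) C :=
    fun y hy => (toReal_coe_add hbot f hy).symm
  obtain ⟨b, hb⟩ := hψ_lb
  have hb' : ∀ y ∈ C, b ≤ f y + φr y := fun y hy => by
    have h1 := hb y hy
    rw [← coe_toReal_of_mem_effDom hψbot (hdom ▸ hy), EReal.coe_le_coe_iff] at h1
    exact h1.trans_eq (hψr hy).symm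
  -- Weak convexity of `f` on the open set `U` serves only to make `f` continuous, so that `ψ`
  -- attains its proximal minima on the closed set `C`.
  have hfc : ContinuousOn f U := by
    obtain ⟨ρ, hρ⟩ := hf_wc
    have h1 := ConvexOn.continuousOn hUo hρ
    have h2 : ContinuousOn (fun y => (f y + ρ / 2 * ‖y‖ ^ 2) - ρ / 2 * ‖y‖ ^ 2) U :=
      h1.sub (by fun_prop)
    simpa using h2
  have hψc : ContinuousOn (fun y => f y + φr y) C :=
    (hfc.mono hφU).add hφ_lip.continuousOn
  have hρ : 0 < 1 / θ - (τ + η) := by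
    rw [sub_pos, lt_div_iff₀ hθ_pos]; linarith
  obtain ⟨p, hp⟩ := exists_isProxMap hθ_pos H.isClosed hne hψc hb'
  have hp' : IsProxMap θ (effDom (compositeObjective D F φ))
      (fun y => (compositeObjective D F φ y).toReal) p := hdom ▸ hp.congr hψr
  have henv : moreauEnv θ (compositeObjective D F φ) = proxEnv θ (fun y => f y + φr y) p := by
    rw [hp'.moreauEnv_eq hψbot]
    ext z
    simp only [proxEnv, ← hψr (hp z).1]
  have hgrad : ∀ z, HasGradientAt (moreauEnv θ (compositeObjective D F φ))
      ((1 / θ) • (z - p z)) z := fun z =>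
    henv ▸ hp.hasGradientAt H.weaklyConvexOn_objective hθ_pos hρ z
  have hnorm : ∀ z, ‖gradient (moreauEnv θ (compositeObjective D F φ)) z‖
      = 1 / θ * ‖z - p z‖ := fun z => by
    rw [(hgrad z).gradient, norm_smul, Real.norm_of_nonneg (by positivity)]
  obtain ⟨hmean, has⟩ := H.tendsto_norm_sub_prox hp hθ_pos hρ hb' hα_sum hα_sq
  refine ⟨fun z => ⟨p z, hp'.isMinOn_proxObjective hψbot z, ?_⟩,
    fun z => (hgrad z).hasFDerivAt.differentiableAt, ?_, ?_, ?_⟩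
  · rw [hp'.proxObjective_eq hψbot, hp'.moreauEnv_eq hψbot]
  · simp only [hnorm]
    exact fun k => (integrable_norm_sub (H.memLp_two k)
      (H.memLp_two_prox hp hθ_pos hρ k)).const_mul _
  · simp only [hnorm, integral_const_mul]
    simpa using hmean.const_mul (1 / θ)
  · simp only [hnorm]
    filter_upwards [has] with ω hω
    simpa using hω.const_mul (1 / θ)
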